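/- **Conventions.** A non-deterministic parity automaton of index $[0,2k-1]$ over a finite alphabet $\Pi$ has a finite state set $Q$, initial states $I\subseteq Q$ and transitions $\Delta\subseteq Q\times\Pi\times[0,2k-1]\times Q$; a run is accepting if the limit inferior of its priorities is even. Automata may also have $\varepsilon$-transitions, i.e. be automata over $\Pi\uplus\{\varepsilon\}$; the language is then the set of $w\in\Pi^\omega$ obtained by erasing all $\varepsilon$'s from some accepted word (for automata without $\varepsilon$-transitions this is the usual language). Write $p\xrightarrow{\varepsilon:c}q$ for the existence of an $\varepsilon$-transition of priority $c$ from $p$ to $q$. The automaton is *$\varepsilon$-complete* if $k\ge 1$, the relations $\xrightarrow{\varepsilon:1},\xrightarrow{\varepsilon:3},\dots,\xrightarrow{\varepsilon:2k-1}$ are total preorders on $Q$, each refining (being contained in) the previous one, and for every even $c<2k$: $p\xrightarrow{\varepsilon:c}q$ if and only if not $q\xrightarrow{\varepsilon:c+1}p$. It is *$\varepsilon$-completable* if adding $\varepsilon$-transitions (same states, initial states and index) can make it $\varepsilon$-complete without enlarging its language. An *ordered Büchi automaton* is $(S,\preceq,I,\Gamma)$ with $S$ a finite set totally ordered by $\preceq$,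 $I\subseteq S$ downwards closed, and $\Gamma$ a set of tiles $t\subseteq S\times\{0,1\}\times S$, each upwards closed for the order: $(p,c,q)\sqsubseteq(p',c',q')$ iff $p\preceq p'$, $q'\preceq q$, and $c\le c'$ in case $(p,q)=(p',q')$. A word $t_0t_1\cdots\in\Gamma^\omega$ is in its language if there are $q_0\in I$ and $(q_j,r_j,q_{j+1})\in t_j$ for all $j$, with $r_j=0$ for infinitely many $j$. It *recognizes* $L\subseteq\Pi^\omega$ via $f:\Pi\to\Gamma$ if, for all $w\in\Pi^\omega$, $w\in L$ if and only if $f(w_0)f(w_1)\cdots$ is in its language. **Theorem.** For every $\varepsilon$-completable non-deterministic parity automaton $A$ with $n$ states and index $[0,2k-1]$ there is an ordered Büchi automaton with $kn$ states that recognizes the language of $A$ via some $f:\Pi\to\Gamma$. Moreover this is effective: there is a computable function that maps every finite description of an $\varepsilon$-completable automaton $A$ (with alphabet $\{0,\dots,m-1\}$, states $\{0,\dots,n-1\}$ and index $[0,2k-1]$, given by $m,n,k$ and the lists of its initial states and transitions) to a finite description of such an ordered Büchi automaton, on the states $0\prec 1\prec\dots\prec kn-1$, and of such an $f$ (with $\Gamma=f(\Pi)$).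 -/

import Mathlib

/-- A sequence of priorities is parity accepting (min-parity) if its limit inferior is even. It is
only applied to sequences with values in a finite interval `[0, N-1]`. -/
def ParityAccepting (c : ℕ → ℕ) : Prop := Even (Filter.liminf c Filter.atTop)

/-- Non-deterministic parity automata over the alphabet `α`, with state set `Q` and index
`[0, N-1]`; `(q, a, c, q') ∈ trans` is a transition from `q` to `q'` over `a` of priority `c`. -/
structure ParityAutomaton (α Q : Type*) (N : ℕ) where
  init : Set Q
  trans : Set (Q × α × Fin N × Q)

namespace ParityAutomaton

variable {α Q : Type*} {N : ℕ}

/-- `(q i, w i, c i, q (i + 1))`, for `i = 0, 1, …`, is a run over the infinite word `w`. -/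
def IsRun (A : ParityAutomaton α Q N) (w : ℕ → α) (q : ℕ → Q) (c : ℕ → Fin N) : Prop :=
  q 0 ∈ A.init ∧ ∀ i, (q i, w i, c i, q (i + 1)) ∈ A.trans

/-- The language of an automaton: the infinite words that have an accepting run. -/
def language (A : ParityAutomaton α Q N) : Set (ℕ → α) :=
  {w | ∃ q c, A.IsRun w q c ∧ ParityAccepting fun i => (c i : ℕ)}

end ParityAutomaton

/-- Parity automata with `ε`-transitions over `α`: the alphabet is `α ⊎ {ε}`, with `ε = none`. -/
abbrev EpsAutomaton (α Q : Type*) (N : ℕ) := ParityAutomaton (Option α) Q N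

/-- The infinite word `w` is obtained from `v` by removing all occurrences of `ε`: `g` enumerates
increasingly the positions of the other letters of `v`, and these letters are, in order, `w`. -/
def IsErasure {α : Type*} (v : ℕ → Option α) (w : ℕ → α) : Prop :=
  ∃ g : ℕ → ℕ, StrictMono g ∧ Set.range g = {i | v i ≠ none} ∧ ∀ j, v (g j) = some (w j)

namespace EpsAutomaton

variable {α Q : Type*} {N : ℕ}

/-- The language over `α` of an automaton with `ε`-transitions. -/
def epsLanguage (A : EpsAutomaton α Q N) : Set (ℕ → α) :=
  {w | ∃ v ∈ ParityAutomaton.language A, IsErasure v w}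

/-- `A.EpsStep c p q` says that `A` has an `ε`-transition of priority `c` from `p` to `q`. -/
def EpsStep (A : EpsAutomaton α Q N) (c : ℕ) (p q : Q) : Prop :=
  ∃ h : c < N, (p, none, ⟨c, h⟩, q) ∈ A.trans

/-- `ε`-complete automata of index `[0, 2k-1]`, `k ≥ 1`: the relations given by the `ε`-transitions
of priorities `1, 3, …, 2k-1` are total preorders, each refining the previous one, and the
`ε`-transitions of priority `2i` form the strict variant of those of priority `2i+1`. -/
structure IsEpsComplete {k : ℕ} (A : EpsAutomaton α Q (2 * k)) : Prop where
  pos : 0 < k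
  total : ∀ i < k, ∀ p q, A.EpsStep (2 * i + 1) p q ∨ A.EpsStep (2 * i + 1) q p
  trans : ∀ i < k, ∀ p q r,
    A.EpsStep (2 * i + 1) p q → A.EpsStep (2 * i + 1) q r → A.EpsStep (2 * i + 1) p r
  refines : ∀ i, i + 1 < k → ∀ p q, A.EpsStep (2 * (i + 1) + 1) p q → A.EpsStep (2 * i + 1) p q
  strict : ∀ i < k, ∀ p q, A.EpsStep (2 * i) p q ↔ ¬ A.EpsStep (2 * i + 1) q p

/-- `A` is `ε`-completable if one can add `ε`-transitions to it (same states, initial states and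
index, same transitions over the letters of `α`) so as to get an `ε`-complete automaton whose
language is not larger. -/
def IsEpsCompletable {k : ℕ} (A : EpsAutomaton α Q (2 * k)) : Prop :=
  ∃ A' : EpsAutomaton α Q (2 * k),
    A'.init = A.init ∧ A.trans ⊆ A'.trans ∧
    (∀ p (a : α) c q, (p, some a, c, q) ∈ A'.trans → (p, some a, c, q) ∈ A.trans) ∧
    A'.IsEpsComplete ∧ A'.epsLanguage ⊆ A.epsLanguage

/-- An automaton over `α`, seen as an automaton with `ε`-transitions that has none. -/
def ofPlain (A : ParityAutomaton α Q N) : EpsAutomaton α Q N where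
  init := A.init
  trans := {t | ∃ p a c q, t = (p, some a, c, q) ∧ (p, a, c, q) ∈ A.trans}

/-- For automata without `ε`-transitions, the two notions of language agree. -/
theorem epsLanguage_ofPlain (A : ParityAutomaton α Q N) :
    (ofPlain A).epsLanguage = A.language := by
  ext w
  constructor
  · rintro ⟨v, ⟨q, c, ⟨h0, hs⟩, hacc⟩, g, hg, hr, hv⟩
    have hne : ∀ i, v i ≠ none := by
      intro i hi
      obtain ⟨p, a, c', q', h, -⟩ := hs i
      simp [hi] at h
    have hid : g = id := by
      apply hg.range_inj strictMono_id |>.1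
      rw [hr, Set.range_id]
      ext i
      simp [hne i]
    refine ⟨q, c, ⟨h0, fun i => ?_⟩, hacc⟩
    obtain ⟨p, a, c', q', h, hm⟩ := hs i
    have hi := hv i
    simp only [hid, id] at hi
    simp only [hi, Prod.mk.injEq, Option.some.injEq] at h
    obtain ⟨rfl, rfl, rfl, h4⟩ := h
    rw [h4]
    exact hm
  · rintro ⟨q, c, ⟨h0, hs⟩, hacc⟩
    refine ⟨fun i => some (w i), ⟨q, c, ⟨h0, fun i => ⟨_, _, _, _, rfl, hs i⟩⟩, hacc⟩,
      id, strictMono_id, ?_, fun _ => rfl⟩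
    ext i
    simp

end EpsAutomaton

/-- Büchi tiles over `Q`: sets of transitions `(p, c, q)` with `c ∈ {0, 1}`. -/
abbrev BuchiTile (Q : Type*) := Set (Q × Fin 2 × Q)

/-- The order on Büchi transitions over a totally ordered state set: `(p, c, q) ⊑ (p', c', q')` if
`p ≤ p'`, `q' ≤ q` and, in case `(p, q) = (p', q')`, `c ≤ c'`. -/
def TransLE {Q : Type*} [LinearOrder Q] (d d' : Q × Fin 2 × Q) : Prop :=
  d.1 ≤ d'.1 ∧ d'.2.2 ≤ d.2.2 ∧ (d.1 = d'.1 ∧ d.2.2 = d'.2.2 → d.2.1 ≤ d'.2.1)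

/-- Ordered Büchi automata over the (finite) totally ordered state set `Q`: a downwards-closed set
of initial states and a set of Büchi tiles (the alphabet), each upwards-closed for `TransLE`. -/
structure OrderedBuchiAutomaton (Q : Type*) [LinearOrder Q] where
  init : Set Q
  init_lower : ∀ p q, p ≤ q → q ∈ init → p ∈ init
  tiles : Set (BuchiTile Q)
  tiles_upper : ∀ t ∈ tiles, ∀ d d', d ∈ t → TransLE d d' → d' ∈ t

namespace OrderedBuchiAutomaton

variable {α Q : Type*} [LinearOrder Q]

/-- The language of an ordered Büchi automaton: the infinite words of tiles of its alphabet that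
have an accepting run. -/
def language (B : OrderedBuchiAutomaton Q) : Set (ℕ → B.tiles) :=
  {w | ∃ (q : ℕ → Q) (r : ℕ → Fin 2), q 0 ∈ B.init ∧
    (∀ j, (q j, r j, q (j + 1)) ∈ (w j : BuchiTile Q)) ∧ ParityAccepting fun j => (r j : ℕ)}

/-- `B` recognizes the language `L` over `α` through the renaming `f` of letters into tiles. -/
def RecognizesVia (B : OrderedBuchiAutomaton Q) (f : α → B.tiles) (L : Set (ℕ → α)) : Prop :=
  ∀ w : ℕ → α, w ∈ L ↔ (fun i => f (w i)) ∈ B.language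

end OrderedBuchiAutomaton

/-- Finite descriptions `(m, n, k, I, Δ)` of automata with `ε`-transitions over the alphabet
`{0, …, m-1}`, with states `{0, …, n-1}`, index `[0, 2k-1]`, list of initial states `I` and list of
transitions `Δ` (entries that are out of range being ignored). -/
abbrev EpsAutomatonCode := ℕ × ℕ × ℕ × List ℕ × List (ℕ × Option ℕ × ℕ × ℕ)

/-- The automaton described by `(m, n, k, I, Δ)`. -/
def codedEpsAutomaton (m n k : ℕ) (I : List ℕ) (D : List (ℕ × Option ℕ × ℕ × ℕ)) :
    EpsAutomaton (Fin m) (Fin n) (2 * k) where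
  init := {q | (q : ℕ) ∈ I}
  trans := {t | ((t.1 : ℕ), t.2.1.map Fin.val, (t.2.2.1 : ℕ), (t.2.2.2 : ℕ)) ∈ D}

/-- Finite descriptions `(I, T)` of ordered Büchi automata with a renaming of letters: the list of
initial states, and the list of all `(a, p, c, q)` where `(p, c, q)` is in the tile of letter `a`. -/
abbrev OrderedBuchiCode := List ℕ × List (ℕ × ℕ × ℕ × ℕ)

/-- `(I, T)` describes the ordered Büchi automaton `B` with states `0 < 1 < … < s-1`, together with
the renaming `f` of the letters `0, …, m-1` into its tiles, every tile of `B` being one of them. -/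
def OrderedBuchiCode.Describes {m s : ℕ} (y : OrderedBuchiCode)
    (B : OrderedBuchiAutomaton (Fin s)) (f : Fin m → B.tiles) : Prop :=
  (∀ q : Fin s, q ∈ B.init ↔ (q : ℕ) ∈ y.1) ∧
  (∀ (a : Fin m) (p : Fin s) (c : Fin 2) (q : Fin s),
    (p, c, q) ∈ (f a : BuchiTile (Fin s)) ↔ ((a : ℕ), (p : ℕ), (c : ℕ), (q : ℕ)) ∈ y.2) ∧
  Function.Surjective f

/-- `l` is the limit inferior of the sequence `c` of natural numbers. -/
def HasLimInf (c : ℕ → ℕ) (l : ℕ) : Prop :=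
  (∃ M, ∀ i, M ≤ i → l ≤ c i) ∧ ∀ M, ∃ i, M ≤ i ∧ c i = l

theorem HasLimInf.liminf_eq {c : ℕ → ℕ} {l : ℕ} (h : HasLimInf c l) :
    Filter.liminf c Filter.atTop = l := by
  obtain ⟨⟨M, hM⟩, hf⟩ := h
  have hfreq : ∃ᶠ i in Filter.atTop, c i ≤ l := by
    rw [Filter.frequently_atTop]
    intro a
    obtain ⟨i, hi, e⟩ := hf a
    exact ⟨i, hi, e.le⟩
  apply le_antisymm
  · exact Filter.liminf_le_of_frequently_le hfreq
      (Filter.isBoundedUnder_of ⟨0, fun _ => Nat.zero_le _⟩)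
  · refine Filter.le_liminf_of_le ?_ (Filter.eventually_atTop.2 ⟨M, hM⟩)
    exact Filter.IsCoboundedUnder.of_frequently_le hfreq

/-- The least value taken infinitely often; one exists by pigeonhole. -/
theorem exists_hasLimInf {c : ℕ → ℕ} {N : ℕ} (hb : ∀ i, c i < N) : ∃ l, HasLimInf c l := by
  classical
  have hex : ∃ l, ∀ M, ∃ i, M ≤ i ∧ c i = l := by
    by_contra! hcon
    choose M hM using hcon
    have hle : ∀ x ∈ Finset.range N, M x ≤ (Finset.range N).sup M := fun x hx =>
      Finset.le_sup (f := M) hx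
    exact hM (c ((Finset.range N).sup M)) _ (hle _ (Finset.mem_range.2 (hb _))) rfl
  refine ⟨Nat.find hex, ?_, Nat.find_spec hex⟩
  have hlt : ∀ x, x < Nat.find hex → ∃ M, ∀ i, M ≤ i → c i ≠ x := by
    intro x hx
    simpa using Nat.find_min hex hx
  choose! M hM using hlt
  refine ⟨(Finset.range (Nat.find hex)).sup M, fun i hi => ?_⟩
  by_contra! hcon
  exact hM _ hcon i ((Finset.le_sup (f := M) (Finset.mem_range.2 hcon)).trans hi) rfl

/-- Acceptance in the sense of an attained even limit inferior. -/
def EvenLimInf (c : ℕ → ℕ) : Prop := ∃ l, Even l ∧ HasLimInf c l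

/-- The bound is needed: for a sequence tending to infinity, `liminf` in `ℕ` defaults to `0`, which
is even. -/
theorem parityAccepting_iff_evenLimInf {c : ℕ → ℕ} {N : ℕ} (hb : ∀ i, c i < N) :
    ParityAccepting c ↔ EvenLimInf c := by
  constructor
  · intro h
    obtain ⟨l, hl⟩ := exists_hasLimInf hb
    refine ⟨l, ?_, hl⟩
    rwa [ParityAccepting, hl.liminf_eq] at h
  · rintro ⟨l, he, hl⟩
    rwa [ParityAccepting, hl.liminf_eq]

theorem exists_block {g : ℕ → ℕ} (hg : StrictMono g) (h0 : g 0 = 0) (t : ℕ) :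
    ∃ j, g j ≤ t ∧ t < g (j + 1) := by
  classical
  refine ⟨Nat.findGreatest (fun j => g j ≤ t) t, ?_, ?_⟩
  · exact Nat.findGreatest_spec (P := fun j => g j ≤ t) (Nat.zero_le t) (by simp [h0])
  · by_contra! hcon
    have := Nat.le_findGreatest (P := fun j => g j ≤ t) ((hg.le_apply).trans hcon) hcon
    omega

theorem block_unique {g : ℕ → ℕ} (hg : StrictMono g) {t j j' : ℕ} (h : g j ≤ t)
    (h' : t < g (j + 1)) (k : g j' ≤ t) (k' : t < g (j' + 1)) : j = j' := by
  have h1 := hg.lt_iff_lt.1 (h.trans_lt k')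
  have h2 := hg.lt_iff_lt.1 (k.trans_lt h')
  omega

/-- `c j` is the minimum of `d` over the `j`-th block `[g j, g (j+1))`. -/
def IsBlockMin (g c d : ℕ → ℕ) : Prop :=
  ∀ j, (∀ t, g j ≤ t → t < g (j + 1) → c j ≤ d t) ∧ ∃ t, g j ≤ t ∧ t < g (j + 1) ∧ d t = c j

/-- Blocks are finite and their minima are attained, so passing to minima neither creates nor loses
a value that bounds a tail and recurs. -/
theorem IsBlockMin.hasLimInf_iff {g c d : ℕ → ℕ} (hg : StrictMono g) (h0 : g 0 = 0)
    (h : IsBlockMin g c d) (l : ℕ) : HasLimInf c l ↔ HasLimInf d l := by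
  constructor
  · rintro ⟨⟨M, hM⟩, hf⟩
    refine ⟨⟨g M, fun i hi => ?_⟩, fun K => ?_⟩
    · obtain ⟨j, hj, hj'⟩ := exists_block hg h0 i
      have h1 := hg.lt_iff_lt.1 (hi.trans_lt hj')
      exact (hM j (by omega)).trans ((h j).1 i hj hj')
    · obtain ⟨j, hj, e⟩ := hf K
      obtain ⟨t, ht, -, ht'⟩ := (h j).2
      exact ⟨t, hj.trans (hg.le_apply.trans ht), ht'.trans e⟩
  · rintro ⟨⟨M, hM⟩, hf⟩
    have hlow : ∀ j, M ≤ j → l ≤ c j := fun j hj => by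
      obtain ⟨t, ht, -, ht'⟩ := (h j).2
      exact ht' ▸ hM t (hj.trans (hg.le_apply.trans ht))
    refine ⟨⟨M, hlow⟩, fun K => ?_⟩
    obtain ⟨t, ht, e⟩ := hf (g (max M K))
    obtain ⟨j, hj, hj'⟩ := exists_block hg h0 t
    have h1 := hg.lt_iff_lt.1 (ht.trans_lt hj')
    have h2 := (h j).1 t hj hj'
    have h3 := hlow j (by omega)
    exact ⟨j, by omega, by omega⟩

/-! ### Transitions induced by finite factors -/

section Segments

variable {Q β : Type*}

/-- Composition of sets of transitions, with minimum of priorities. -/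
def relComp (X Y : Set (Q × ℕ × Q)) : Set (Q × ℕ × Q) :=
  {t | ∃ u ∈ X, ∃ v ∈ Y, u.2.2 = v.1 ∧ t = (u.1, min u.2.1 v.2.1, v.2.2)}

theorem mem_relComp {X Y : Set (Q × ℕ × Q)} {p r : Q} {c : ℕ} :
    (p, c, r) ∈ relComp X Y ↔
      ∃ q a b, (p, a, q) ∈ X ∧ (q, b, r) ∈ Y ∧ c = min a b := by
  constructor
  · rintro ⟨⟨p', a, q⟩, hu, ⟨q', b, r'⟩, hv, rfl, h⟩
    simp only [Prod.mk.injEq] at h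
    obtain ⟨rfl, rfl, rfl⟩ := h
    exact ⟨_, _, _, hu, hv, rfl⟩
  · rintro ⟨q, a, b, hu, hv, rfl⟩
    exact ⟨_, hu, _, hv, rfl, rfl⟩

theorem relComp_assoc (X Y Z : Set (Q × ℕ × Q)) :
    relComp (relComp X Y) Z = relComp X (relComp Y Z) := by
  ext ⟨p, c, q⟩
  simp only [mem_relComp]
  constructor
  · rintro ⟨r, a, b, ⟨s, a', b', h1, h2, rfl⟩, h3, rfl⟩
    exact ⟨s, a', _, h1, ⟨r, _, _, h2, h3, rfl⟩, min_assoc _ _ _⟩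
  · rintro ⟨r, a, b, h1, ⟨s, a', b', h2, h3, rfl⟩, rfl⟩
    exact ⟨s, _, b', ⟨r, _, _, h1, h2, rfl⟩, h3, (min_assoc _ _ _).symm⟩

/-- The transitions induced by the factor `w i ⋯ w (i + l)` of `w`. -/
def factorRel (M : β → Set (Q × ℕ × Q)) (w : ℕ → β) (i : ℕ) : ℕ → Set (Q × ℕ × Q)
  | 0 => M (w i)
  | l + 1 => relComp (factorRel M w i l) (M (w (i + l + 1)))

theorem relComp_factorRel (M : β → Set (Q × ℕ × Q)) (w : ℕ → β) (i l l' : ℕ) :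
    relComp (factorRel M w i l) (factorRel M w (i + l + 1) l') = factorRel M w i (l + l' + 1) := by
  induction l' with
  | zero => rfl
  | succ l' ih =>
    rw [factorRel, ← relComp_assoc, ih, ← Nat.add_assoc l l' 1, factorRel]
    congr 3
    omega

theorem factorRel_congr (M : β → Set (Q × ℕ × Q)) {w w' : ℕ → β} {i i' l : ℕ}
    (h : ∀ t, t ≤ l → w (i + t) = w' (i' + t)) : factorRel M w i l = factorRel M w' i' l := by
  induction l with
  | zero => simpa [factorRel] using congrArg M (h 0 le_rfl)
  | succ l ih =>
    have := h (l + 1) le_rfl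
    rw [factorRel, factorRel, ih fun t ht => h t (by omega), Nat.add_assoc, this, Nat.add_assoc]

/-- The priority is given as an attained lower bound along an explicit path, the form required by
`IsBlockMin`. -/
theorem mem_factorRel {M : β → Set (Q × ℕ × Q)} {w : ℕ → β} {i l : ℕ} {p q : Q} {c : ℕ} :
    (p, c, q) ∈ factorRel M w i l ↔ ∃ (s : ℕ → Q) (d : ℕ → ℕ), s i = p ∧ s (i + l + 1) = q ∧
      (∀ t, i ≤ t → t < i + l + 1 → (s t, d t, s (t + 1)) ∈ M (w t)) ∧
      (∀ t, i ≤ t → t < i + l + 1 → c ≤ d t) ∧ ∃ t, i ≤ t ∧ t < i + l + 1 ∧ d t = c := by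
  induction l generalizing q c with
  | zero =>
    constructor
    · intro h
      refine ⟨fun t => if t = i then p else q, fun _ => c, by simp, by simp, ?_, ?_, i, ?_⟩
      · intro t h1 h2
        obtain rfl : t = i := by omega
        simpa [factorRel] using h
      · simp
      · simp
    · rintro ⟨s, d, rfl, rfl, h, -, t, h1, h2, rfl⟩
      obtain rfl : t = i := by omega
      exact h t h1 h2
  | succ l ih =>
    rw [factorRel, mem_relComp]
    constructor
    · rintro ⟨r, a, b, h1, h2, rfl⟩
      obtain ⟨s, d, rfl, rfl, hs, hm, t, ht, ht', rfl⟩ := ih.1 h1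
      refine ⟨fun t => if t ≤ i + l + 1 then s t else q,
        fun t => if t < i + l + 1 then d t else b, if_pos (by omega), if_neg (by omega), ?_, ?_, ?_⟩
      · intro x hx hx'
        rcases Nat.lt_or_ge x (i + l + 1) with h | h
        · have := hs x hx h
          simpa [h, h.le, Nat.succ_le_of_lt h] using this
        · obtain rfl : x = i + l + 1 := by omega
          simpa using h2
      · intro x hx hx'
        rcases Nat.lt_or_ge x (i + l + 1) with h | h
        · simpa only [h, if_true] using (min_le_left _ _).trans (hm x hx h)
        · simp only [Nat.not_lt.2 h, if_false, min_le_right]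
      · rcases le_total (d t) b with h | h
        · exact ⟨t, ht, by omega, by simp only [ht', h, if_true, min_eq_left]⟩
        · exact ⟨i + l + 1, by omega, by omega, by simp [h]⟩
    · rintro ⟨s, d, rfl, rfl, hs, hm, t, ht, ht', rfl⟩
      have hne : (Finset.Ico i (i + l + 1)).Nonempty := ⟨i, by simp⟩
      obtain ⟨x, hx, hmin⟩ := Finset.exists_min_image (Finset.Ico i (i + l + 1)) d hne
      simp only [Finset.mem_Ico, and_imp] at hx hmin
      refine ⟨s (i + l + 1), d x, d (i + l + 1), ih.2 ⟨s, d, rfl, rfl, fun y hy hy' =>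
        hs y hy (by omega), hmin, x, hx.1, hx.2, rfl⟩, hs _ (by omega) (by omega), ?_⟩
      have h1 := hm x hx.1 (by omega)
      have h2 := hm (i + l + 1) (by omega) (by omega)
      rcases Nat.lt_or_ge t (i + l + 1) with h | h
      · have := hmin t ht h
        omega
      · obtain rfl : t = i + l + 1 := by omega
        omega

/-- The infinite words that have an accepting run, for the transitions `M a` over the letter `a`. -/
def acceptedWords (I : Set Q) (M : β → Set (Q × ℕ × Q)) : Set (ℕ → β) :=
  {w | ∃ (q : ℕ → Q) (c : ℕ → ℕ), q 0 ∈ I ∧ (∀ i, (q i, c i, q (i + 1)) ∈ M (w i)) ∧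
    EvenLimInf c}

/-- Contracting each block of a run to one transition preserves the lim inf, and paths chosen block
by block can be glued. This serves both to eliminate ε's and to pass to Ramsey factorizations. The
`- 1` is there because `factorRel` is indexed by length minus one. -/
theorem mem_acceptedWords_iff_blocks {I : Set Q} {M : β → Set (Q × ℕ × Q)} {w : ℕ → β}
    {g : ℕ → ℕ} (hg : StrictMono g) (h0 : g 0 = 0) :
    w ∈ acceptedWords I M ↔ ∃ (q : ℕ → Q) (c : ℕ → ℕ), q 0 ∈ I ∧
      (∀ j, (q j, c j, q (j + 1)) ∈ factorRel M w (g j) (g (j + 1) - g j - 1)) ∧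
      EvenLimInf c := by
  have hlen : ∀ j, g j + (g (j + 1) - g j - 1) + 1 = g (j + 1) := fun j => by
    have := hg (Nat.lt_succ_self j)
    simp only [Nat.succ_eq_add_one] at this
    omega
  simp only [mem_factorRel, hlen]
  constructor
  · rintro ⟨q, d, hq, hs, l, hl, hlim⟩
    have hne : ∀ j, (Finset.Ico (g j) (g (j + 1))).Nonempty := fun j =>
      ⟨g j, by simpa using hg (Nat.lt_succ_self j)⟩
    choose x hx hmin using fun j => Finset.exists_min_image (Finset.Ico (g j) (g (j + 1))) d (hne j)
    simp only [Finset.mem_Ico, and_imp] at hx hmin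
    refine ⟨fun j => q (g j), fun j => d (x j), by simpa [h0], fun j => ⟨q, d, rfl, rfl,
      fun t _ _ => hs t, hmin j, x j, (hx j).1, (hx j).2, rfl⟩, l, hl, ?_⟩
    exact (IsBlockMin.hasLimInf_iff hg h0
      (fun j => ⟨hmin j, x j, (hx j).1, (hx j).2, rfl⟩) l).2 hlim
  · rintro ⟨q, c, hq, hs, l, hl, hlim⟩
    choose s d hs1 hs2 hstep hmin hatt using hs
    choose b hb hb' using exists_block hg h0
    have hbu : ∀ j t, g j ≤ t → t < g (j + 1) → b t = j := fun j t h h' =>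
      block_unique hg (hb t) (hb' t) h h'
    refine ⟨fun t => s (b t) t, fun t => d (b t) t, ?_, fun t => ?_, l, hl, ?_⟩
    · have : b 0 = 0 := hbu 0 0 h0.le (by simpa [h0] using hg (Nat.lt_succ_self 0))
      have h1 := hs1 0
      rw [h0] at h1
      simpa [this, h1] using hq
    · have := hstep (b t) t (hb t) (hb' t)
      beta_reduce
      rcases Nat.lt_or_ge (t + 1) (g (b t + 1)) with h | h
      · rwa [hbu (b t) (t + 1) ((hb t).trans (Nat.le_succ t)) h]
      -- At a block boundary the path changes: the end of one and the start of the next are the same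
      -- `q`.
      · have h1 := hb' t
        have h2 : t + 1 = g (b t + 1) := by omega
        have h3 : b (t + 1) = b t + 1 := hbu _ _ h2.ge (h2 ▸ hg (Nat.lt_succ_self _))
        rw [h3]
        simp only [h2, hs1] at this ⊢
        rwa [hs2] at this
    · refine (IsBlockMin.hasLimInf_iff hg h0 (fun j => ⟨fun t h h' => ?_, ?_⟩) l).1 hlim
      · simp only [hbu j t h h']
        exact hmin j t h h'
      · obtain ⟨t, h, h', e⟩ := hatt j
        exact ⟨t, h, h', by simpa [hbu j t h h'] using e⟩

end Segments

/-! ### Elimination of ε-transitions -/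

namespace ParityAutomaton

variable {α Q : Type*} {N : ℕ}

/-- The transitions of `A` over the letter `a`, with natural numbers as priorities. -/
def letterRel (A : ParityAutomaton α Q N) (a : α) : Set (Q × ℕ × Q) :=
  {t | ∃ h : t.2.1 < N, (t.1, a, ⟨t.2.1, h⟩, t.2.2) ∈ A.trans}

theorem language_eq_acceptedWords (A : ParityAutomaton α Q N) :
    A.language = acceptedWords A.init A.letterRel := by
  ext w
  constructor
  · rintro ⟨q, c, ⟨h0, hs⟩, hacc⟩
    exact ⟨q, fun i => c i, h0, fun i => ⟨(c i).2, hs i⟩,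
      (parityAccepting_iff_evenLimInf fun i => (c i).2).1 hacc⟩
  · rintro ⟨q, c, h0, hs, hacc⟩
    choose hb hs using hs
    exact ⟨q, fun i => ⟨c i, hb i⟩, ⟨h0, hs⟩, (parityAccepting_iff_evenLimInf hb).2 hacc⟩

end ParityAutomaton

namespace EpsAutomaton

variable {α Q : Type*} {N : ℕ}

/-- Finite sequences of `ε`-transitions with their minimal priority (`N` for the empty one). -/
inductive EpsPath (A : EpsAutomaton α Q N) : Q → ℕ → Q → Prop
  | refl (p : Q) : EpsPath A p N p
  | step {p q r : Q} {c d : ℕ} : EpsPath A p c q → (q, d, r) ∈ ParityAutomaton.letterRel A none →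
      EpsPath A p (min c d) r

/-- Sequences of `ε`-transitions followed by a transition over the letter `a`. -/
def epsLetterRel (A : EpsAutomaton α Q N) (a : α) : Set (Q × ℕ × Q) :=
  {t | ∃ p c d, EpsPath A t.1 c p ∧ (p, d, t.2.2) ∈ ParityAutomaton.letterRel A (some a) ∧
    t.2.1 = min c d}

theorem epsPath_of_mem_factorRel (A : EpsAutomaton α Q N) {v : ℕ → Option α} {i l : ℕ}
    (hv : ∀ t, t ≤ l → v (i + t) = none) {p q : Q} {c : ℕ}
    (h : (p, c, q) ∈ factorRel (ParityAutomaton.letterRel A) v i l) : EpsPath A p c q := by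
  induction l generalizing c q with
  | zero =>
    have h0 := hv 0 le_rfl
    rw [Nat.add_zero] at h0
    rw [factorRel, h0] at h
    have hc : c < N := h.1
    simpa [min_eq_right hc.le] using (EpsPath.refl p).step h
  | succ l ih =>
    rw [factorRel, mem_relComp] at h
    obtain ⟨r, a, b, h1, h2, rfl⟩ := h
    rw [Nat.add_assoc, hv (l + 1) le_rfl] at h2
    exact (ih (fun t ht => hv t (by omega)) h1).step h2

theorem mem_epsLetterRel_of_mem_factorRel (A : EpsAutomaton α Q N) {v : ℕ → Option α} {i l : ℕ}
    {a : α} (hv : ∀ t, t < l → v (i + t) = none) (hl : v (i + l) = some a) {p q : Q} {c : ℕ}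
    (h : (p, c, q) ∈ factorRel (ParityAutomaton.letterRel A) v i l) :
    (p, c, q) ∈ epsLetterRel A a := by
  cases l with
  | zero =>
    rw [Nat.add_zero] at hl
    rw [factorRel, hl] at h
    have hc : c < N := h.1
    exact ⟨p, N, c, .refl p, h, (min_eq_right hc.le).symm⟩
  | succ l =>
    rw [factorRel, mem_relComp] at h
    obtain ⟨r, x, y, h1, h2, rfl⟩ := h
    rw [Nat.add_assoc, hl] at h2
    exact ⟨r, x, y, epsPath_of_mem_factorRel A (fun t ht => hv t (by omega)) h1, h2, rfl⟩

/-- The length is chosen before the word and the position, so that the ε's can be laid into a word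
still to be built. The empty path is separate because factors are nonempty. -/
theorem EpsPath.exists_mem_factorRel {A : EpsAutomaton α Q N} {p q : Q} {c : ℕ}
    (h : EpsPath A p c q) : (c = N ∧ p = q) ∨ ∃ l, ∀ (v : ℕ → Option α) (i : ℕ),
      (∀ t, t ≤ l → v (i + t) = none) →
        (p, c, q) ∈ factorRel (ParityAutomaton.letterRel A) v i l := by
  induction h with
  | refl => exact Or.inl ⟨rfl, rfl⟩
  | @step q r c d _ h ih =>
    right
    rcases ih with ⟨rfl, rfl⟩ | ⟨l, hl⟩
    · refine ⟨0, fun v i hv => ?_⟩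
      have h0 := hv 0 le_rfl
      rw [Nat.add_zero] at h0
      have hd : d < c := h.1
      rwa [factorRel, h0, min_eq_right hd.le]
    · refine ⟨l + 1, fun v i hv => ?_⟩
      rw [factorRel, mem_relComp]
      exact ⟨q, c, d, hl v i fun t ht => hv t (by omega), by
        rwa [Nat.add_assoc, hv (l + 1) le_rfl], rfl⟩

theorem exists_mem_factorRel_of_mem_epsLetterRel {A : EpsAutomaton α Q N} {a : α} {p q : Q} {c : ℕ}
    (h : (p, c, q) ∈ epsLetterRel A a) : ∃ l, ∀ (v : ℕ → Option α) (i : ℕ),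
      (∀ t, t < l → v (i + t) = none) → v (i + l) = some a →
        (p, c, q) ∈ factorRel (ParityAutomaton.letterRel A) v i l := by
  obtain ⟨r, x, y, h1, h2, h3⟩ := h
  simp only at h1 h2 h3
  subst h3
  rcases h1.exists_mem_factorRel with ⟨rfl, rfl⟩ | ⟨l, hl⟩
  · refine ⟨0, fun v i _ hv => ?_⟩
    rw [Nat.add_zero] at hv
    have hd : y < x := h2.1
    rwa [factorRel, hv, min_eq_right hd.le]
  · refine ⟨l + 1, fun v i hv hv' => ?_⟩
    rw [factorRel, mem_relComp]
    exact ⟨r, x, y, hl v i fun t ht => hv t (by omega), by rwa [Nat.add_assoc, hv'], rfl⟩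

/-- Cutting `v` after each letter other than ε gives blocks of the form `ε* a`; conversely, each
transition over `ε* a` prescribes how many ε's to insert before the letter. -/
theorem epsLanguage_eq_acceptedWords (A : EpsAutomaton α Q N) :
    A.epsLanguage = acceptedWords A.init (epsLetterRel A) := by
  classical
  ext w
  constructor
  · rintro ⟨v, hv, g, hg, hr, hw⟩
    rw [ParityAutomaton.language_eq_acceptedWords] at hv
    -- Block `j` starts just after the previous letter and ends at the position `g j`.
    let G : ℕ → ℕ := fun j => Nat.casesOn j 0 fun j => g j + 1
    have hG : StrictMono G := by
      refine strictMono_nat_of_lt_succ fun j => ?_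
      cases j with
      | zero => simp [G]
      | succ j => simpa [G] using hg (Nat.lt_succ_self j)
    rw [mem_acceptedWords_iff_blocks hG rfl] at hv
    obtain ⟨q, c, hq, hs, hacc⟩ := hv
    refine ⟨q, c, hq, fun j => mem_epsLetterRel_of_mem_factorRel A ?_ ?_ (hs j), hacc⟩
    · intro t ht
      by_contra hne
      have hmem : G j + t ∈ Set.range g := by rw [hr]; exact hne
      obtain ⟨x, hx⟩ := hmem
      have h1 : g x < g j := by
        have : G (j + 1) = g j + 1 := rfl
        omega
      have h2 := hg.lt_iff_lt.1 h1
      cases j with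
      | zero => omega
      | succ j =>
        have h3 : G (j + 1) = g j + 1 := rfl
        have h4 := hg.monotone (Nat.lt_succ_iff.1 h2)
        omega
    · have h1 := hG (Nat.lt_succ_self j)
      have h2 : G (j + 1) = g j + 1 := rfl
      have h3 : G j + (G (j + 1) - G j - 1) = g j := by
        simp only [Nat.succ_eq_add_one] at h1
        omega
      rw [h3, hw]
  · rintro ⟨q, c, hq, hs, hacc⟩
    choose l hl using fun j => exists_mem_factorRel_of_mem_epsLetterRel (hs j)
    -- Block `j` has `l j` ε's and then its letter, at position `G j + l j`.
    let G : ℕ → ℕ := fun j => ∑ i ∈ Finset.range j, (l i + 1)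
    have hG1 : ∀ j, G (j + 1) = G j + (l j + 1) := fun j => Finset.sum_range_succ _ _
    have hG : StrictMono G := strictMono_nat_of_lt_succ fun j => by rw [hG1]; omega
    have hinj : ∀ j j' t, t ≤ l j → G j + t = G j' + l j' → j = j' ∧ t = l j := by
      intro j j' t ht h
      have h1 : j = j' := block_unique hG (t := G j + t) (by omega) (by rw [hG1]; omega)
        (by omega) (by rw [hG1]; omega)
      subst h1
      exact ⟨rfl, by omega⟩
    let v : ℕ → Option α := fun t => if h : ∃ j, t = G j + l j then some (w h.choose) else none
    have hv1 : ∀ j, v (G j + l j) = some (w j) := by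
      intro j
      have hex : ∃ j', G j + l j = G j' + l j' := ⟨j, rfl⟩
      simp only [v, dif_pos hex]
      rw [← (hinj _ _ _ le_rfl hex.choose_spec).1]
    have hv2 : ∀ j t, t < l j → v (G j + t) = none := by
      intro j t ht
      refine dif_neg ?_
      rintro ⟨j', h⟩
      have := (hinj j j' t ht.le h).2
      omega
    refine ⟨v, ?_, fun j => G j + l j, ?_, ?_, hv1⟩
    · rw [ParityAutomaton.language_eq_acceptedWords, mem_acceptedWords_iff_blocks hG rfl]
      refine ⟨q, c, hq, fun j => ?_, hacc⟩
      have : G (j + 1) - G j - 1 = l j := by rw [hG1]; omega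
      rw [this]
      exact hl j v _ (hv2 j) (hv1 j)
    · refine strictMono_nat_of_lt_succ fun j => ?_
      rw [hG1]
      omega
    · ext t
      constructor
      · rintro ⟨j, rfl⟩
        simp [hv1]
      · intro h
        by_contra hne
        refine h (dif_neg ?_)
        rintro ⟨j, rfl⟩
        exact hne ⟨j, rfl⟩

end EpsAutomaton

/-! ### Ranks and the lexicographic order on nodes -/

/-- Count the elements strictly below `x`; `x` is not one of them, so the rank is less than `n`.
Equivalent elements share a rank, and some ranks may be unused. -/
theorem exists_rank {X : Type*} [Finite X] {n : ℕ} (hn : Nat.card X = n) (le : X → X → Prop)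
    (total : ∀ x y, le x y ∨ le y x) (trans : ∀ x y z, le x y → le y z → le x z) :
    ∃ ρ : X → Fin n, ∀ x y, ρ x ≤ ρ y ↔ le x y := by
  classical
  have hrefl : ∀ x, le x x := fun x => (total x x).elim id id
  refine ⟨fun x => ⟨{y | ¬ le x y}.ncard, ?_⟩, fun x y => ?_⟩
  · rw [← hn, ← Set.ncard_univ]
    exact Set.ncard_lt_ncard ((Set.ssubset_univ_iff).2 fun h => by
      have : x ∈ {y | ¬ le x y} := h ▸ Set.mem_univ x
      exact this (hrefl x)) (Set.toFinite _)
  · rw [Fin.mk_le_mk]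
    constructor
    · intro h
      by_contra hxy
      refine absurd h (not_le.2 (Set.ncard_lt_ncard ?_ (Set.toFinite _)))
      refine ⟨fun z hz hxz => hz (trans _ _ _ ((total x y).resolve_left hxy) hxz), fun hsub => ?_⟩
      exact hsub hxy (hrefl y)
    · intro h
      exact Set.ncard_le_ncard (fun z hz hyz => hz (trans _ _ _ h hyz)) (Set.toFinite _)

section LexNodes

variable {Q : Type*} {k : ℕ}

/-- The lexicographic order on pairs `(i, p)` induced by total preorders `R 0, R 1, …`, where
`R i p q` means that `p` is above `q`: `(i, p)` stands for the sequence of the classes of `p` for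
`R 0, …, R i`, extended by top elements. -/
def NodeLE (R : ℕ → Q → Q → Prop) (x y : Fin k × Q) : Prop :=
  (∃ d : ℕ, d ≤ x.1 ∧ d ≤ y.1 ∧ ¬ R d x.2 y.2) ∨ (y.1 ≤ x.1 ∧ R y.1 y.2 x.2)

variable {R : ℕ → Q → Q → Prop}

theorem nodeLE_total (x y : Fin k × Q) : NodeLE R x y ∨ NodeLE R y x := by
  obtain ⟨i, p⟩ := x
  obtain ⟨j, q⟩ := y
  rcases le_total i j with h | h
  · by_cases h' : R i p q
    · exact Or.inr (Or.inr ⟨h, h'⟩)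
    · exact Or.inl (Or.inl ⟨i, le_rfl, h, h'⟩)
  · by_cases h' : R j q p
    · exact Or.inl (Or.inr ⟨h, h'⟩)
    · exact Or.inr (Or.inl ⟨j, le_rfl, h, h'⟩)

/-- Non-strict comparisons pass to shallower levels by `anti`, so the two hypotheses can be combined
at the shallower of their two witness levels. -/
theorem nodeLE_trans (total : ∀ i < k, ∀ p q, R i p q ∨ R i q p)
    (trans : ∀ i < k, ∀ p q r, R i p q → R i q r → R i p r)
    (anti : ∀ i j, i ≤ j → j < k → ∀ p q, R j p q → R i p q) (x y z : Fin k × Q) (hxy : NodeLE R x y) (hyz : NodeLE R y z) :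
    NodeLE R x z := by
  obtain ⟨i, p⟩ := x
  obtain ⟨j, q⟩ := y
  obtain ⟨l, r⟩ := z
  have hi := i.2
  have hj := j.2
  have hl := l.2
  have hge : ∀ d < k, ∀ p q, ¬ R d p q → R d q p := fun d hd p q h => (total d hd p q).resolve_left h
  simp only [NodeLE, Fin.le_def] at hxy hyz ⊢
  rcases hxy with ⟨d, h1, h2, h3⟩ | ⟨h1, h2⟩ <;> rcases hyz with ⟨e, h4, h5, h6⟩ | ⟨h4, h5⟩
  · left
    rcases le_total d e with h | h
    · exact ⟨d, h1, h.trans h5, fun h' => h3 (trans d (by omega) _ _ _ h'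
        (anti d e h (by omega) _ _ (hge e (by omega) _ _ h6)))⟩
    · exact ⟨e, h.trans h1, h5, fun h' => h6 (trans e (by omega) _ _ _
        (anti e d h (by omega) _ _ (hge d (by omega) _ _ h3)) h')⟩
  · rcases Nat.lt_or_ge l d with h | h
    · exact Or.inr ⟨by omega, trans l hl _ _ _ h5
        (anti l d h.le (by omega) _ _ (hge d (by omega) _ _ h3))⟩
    · exact Or.inl ⟨d, h1, h, fun h' => h3 (trans d (by omega) _ _ _ h' (anti d l h hl _ _ h5))⟩
  · exact Or.inl ⟨e, h4.trans h1, h5, fun h' => h6 (trans e (by omega) _ _ _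
      (anti e j h4 hj _ _ h2) h')⟩
  · exact Or.inr ⟨h4.trans h1, trans l hl _ _ _ h5 (anti l j h4 hj _ _ h2)⟩

end LexNodes

/-! ### The ordered Büchi automaton of an ε-complete automaton -/

namespace EpsAutomaton

variable {α Q : Type*} {k : ℕ} {A : EpsAutomaton α Q (2 * k)}

namespace IsEpsComplete

theorem anti (hA : A.IsEpsComplete) (i j : ℕ) (hij : i ≤ j) (hj : j < k) (p q : Q)
    (h : A.EpsStep (2 * j + 1) p q) : A.EpsStep (2 * i + 1) p q := by
  induction j, hij using Nat.le_induction with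
  | base => exact h
  | succ j _ ih => exact ih (by omega) (hA.refines j hj p q h)

theorem refl (hA : A.IsEpsComplete) {i : ℕ} (hi : i < k) (p : Q) : A.EpsStep (2 * i + 1) p p :=
  (hA.total i hi p p).elim id id

theorem epsStep_down (hA : A.IsEpsComplete) {i c : ℕ} {p q : Q} (h : A.EpsStep c p q)
    (hc : 2 * i ≤ c) : A.EpsStep (2 * i + 1) p q := by
  have hlt := h.1
  obtain ⟨j, rfl | rfl⟩ : ∃ j, c = 2 * j ∨ c = 2 * j + 1 := ⟨c / 2, by omega⟩
  · exact hA.anti i j (by omega) (by omega) p q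
      ((hA.total j (by omega) p q).resolve_right ((hA.strict j (by omega) p q).1 h))
  · exact hA.anti i j (by omega) (by omega) p q h

/-- Every step goes down in the `i`-th preorder, and a step of priority `2 * i` goes strictly down,
which no later step can undo. -/
theorem epsPath_down (hA : A.IsEpsComplete) {i c : ℕ} {p q : Q} (h : A.EpsPath p c q) (hi : i < k)
    (hc : 2 * i ≤ c) :
    A.EpsStep (2 * i + 1) p q ∧ (c = 2 * i → ¬ A.EpsStep (2 * i + 1) q p) := by
  induction h with
  | refl => exact ⟨hA.refl hi p, fun h => by omega⟩
  | @step q r c d _ h ih =>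
    have hs : A.EpsStep d q r := h
    obtain ⟨h1, h2⟩ := ih (by omega)
    have h3 := hA.epsStep_down hs (i := i) (by omega)
    refine ⟨hA.trans i hi _ _ _ h1 h3, fun he hrp => ?_⟩
    rcases le_total c d with hcd | hcd
    · exact h2 (by omega) (hA.trans i hi _ _ _ h3 hrp)
    · obtain rfl : d = 2 * i := by omega
      exact (hA.strict i hi q r).1 hs (hA.trans i hi _ _ _ hrp h1)

/-- A node of the lexicographic order is reached from a larger one by an `ε`-transition. -/
theorem exists_epsStep_of_nodeLE (hA : A.IsEpsComplete) {x y : Fin k × Q}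
    (h : NodeLE (fun i => A.EpsStep (2 * i + 1)) x y) : ∃ e, A.EpsStep e y.2 x.2 ∧
      ((∃ d : ℕ, d ≤ x.1 ∧ d ≤ y.1 ∧ e = 2 * d) ∨ (e = 2 * (y.1 : ℕ) + 1 ∧ y.1 < x.1) ∨
        (e = 2 * (y.1 : ℕ) + 1 ∧ y.1 = x.1 ∧ NodeLE (fun i => A.EpsStep (2 * i + 1)) y x)) := by
  by_cases hd : ∃ d : ℕ, d ≤ x.1 ∧ d ≤ y.1 ∧ ¬ A.EpsStep (2 * d + 1) x.2 y.2
  · obtain ⟨d, h1, h2, h3⟩ := hd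
    exact ⟨2 * d, (hA.strict d (by omega) _ _).2 h3, Or.inl ⟨d, h1, h2, rfl⟩⟩
  · obtain ⟨h1, h2⟩ := h.resolve_left hd
    refine ⟨_, h2, Or.inr ?_⟩
    rcases h1.lt_or_eq with h3 | h3
    · exact Or.inl ⟨rfl, h3⟩
    · refine Or.inr ⟨rfl, h3, Or.inr ⟨h3.ge, ?_⟩⟩
      by_contra hcon
      exact hd ⟨x.1, le_rfl, h3.ge, hcon⟩

end IsEpsComplete

/-- The tile of a letter with transitions `M`: the upwards closure of the transitions
`(ρ (i, p), r, ρ (i, q))` where `M` has a transition from `p` to `q` of priority `c ≥ 2 * i`, and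
`r = 0` only if `c = 2 * i`. -/
def rankTile {n : ℕ} (ρ : Fin k × Q → Fin n) (M : Set (Q × ℕ × Q)) : BuchiTile (Fin n) :=
  {t | ∃ (i : Fin k) (p : Q) (c : ℕ) (q : Q), (p, c, q) ∈ M ∧ 2 * (i : ℕ) ≤ c ∧ ρ (i, p) ≤ t.1 ∧
    t.2.2 ≤ ρ (i, q) ∧ (ρ (i, p) = t.1 → t.2.2 = ρ (i, q) → t.2.1 = 0 → c = 2 * i)}

/-- The ordered Büchi automaton associated with a ranking `ρ` of the pairs `(i, p)`. -/
def rankAutomaton {n : ℕ} (A : EpsAutomaton α Q (2 * k)) (ρ : Fin k × Q → Fin n) :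
    OrderedBuchiAutomaton (Fin n) where
  init := {v | ∃ (i : Fin k) (p : Q), (i : ℕ) = 0 ∧ p ∈ A.init ∧ v ≤ ρ (i, p)}
  init_lower := by
    rintro v v' h ⟨i, p, hi, hp, hv⟩
    exact ⟨i, p, hi, hp, h.trans hv⟩
  tiles := Set.range fun a : α => rankTile ρ (ParityAutomaton.letterRel A (some a))
  tiles_upper := by
    rintro _ ⟨a, rfl⟩ d d' ⟨i, p, c, q, h1, h2, h3, h4, h5⟩ ⟨h6, h7, h8⟩
    refine ⟨i, p, c, q, h1, h2, h3.trans h6, h7.trans h4, fun h9 h10 h11 => ?_⟩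
    have e1 : d.1 = d'.1 := le_antisymm h6 (h9 ▸ h3)
    have e2 : d.2.2 = d'.2.2 := le_antisymm (h10 ▸ h4) h7
    have := h8 ⟨e1, e2⟩
    rw [h11] at this
    exact h5 (h9.trans e1.symm) (e2.trans h10) (Fin.le_zero_iff.1 this)

/-- The renaming of letters into tiles of `rankAutomaton`. -/
def rankRenaming {n : ℕ} (A : EpsAutomaton α Q (2 * k)) (ρ : Fin k × Q → Fin n) (a : α) :
    (rankAutomaton A ρ).tiles :=
  ⟨rankTile ρ (ParityAutomaton.letterRel A (some a)), a, rfl⟩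

variable {n : ℕ} {ρ : Fin k × Q → Fin n}

/-- The ε-prefix leads to a smaller or equal node, so upward closure absorbs it. If it is the prefix
that contributes `2 * i`, the node is strictly smaller and the closure allows Büchi priority `0`
anyway. -/
theorem mem_rankTile_of_mem_epsLetterRel (hA : A.IsEpsComplete)
    (hρ : ∀ x y, ρ x ≤ ρ y ↔ NodeLE (fun i => A.EpsStep (2 * i + 1)) x y) {a : α} {p q : Q}
    {c : ℕ} (h : (p, c, q) ∈ epsLetterRel A a) {i : Fin k} (hc : 2 * (i : ℕ) ≤ c) {v v' : Fin n}
    {r : Fin 2} (hv : ρ (i, p) ≤ v) (hv' : v' ≤ ρ (i, q)) (hr : r = 0 → c = 2 * i) :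
    (v, r, v') ∈ rankTile ρ (ParityAutomaton.letterRel A (some a)) := by
  obtain ⟨p', x, y, h1, h2, h3⟩ := h
  simp only at h1 h2 h3
  obtain ⟨h4, h5⟩ := hA.epsPath_down h1 i.2 (by omega)
  have hle : ρ (i, p') ≤ ρ (i, p) := (hρ _ _).2 (Or.inr ⟨le_rfl, h4⟩)
  refine ⟨i, p', y, q, h2, by omega, hle.trans hv, hv', fun e1 _ e3 => ?_⟩
  have e4 := hr e3
  by_contra hy
  have hx : x = 2 * i := by omega
  have hle' : ρ (i, p) ≤ ρ (i, p') := by simpa [e1] using hv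
  rcases (hρ _ _).1 hle' with ⟨d, g1, g2, g3⟩ | ⟨-, g2⟩
  · exact g3 (hA.anti d i g1 i.2 _ _ h4)
  · exact h5 hx g2

theorem mem_rankAutomaton_language (hA : A.IsEpsComplete)
    (hρ : ∀ x y, ρ x ≤ ρ y ↔ NodeLE (fun i => A.EpsStep (2 * i + 1)) x y) {w : ℕ → α}
    (hw : w ∈ A.epsLanguage) :
    (fun i => rankRenaming A ρ (w i)) ∈ (rankAutomaton A ρ).language := by
  classical
  rw [epsLanguage_eq_acceptedWords] at hw
  obtain ⟨q, c, hq, hs, l, ⟨m, rfl⟩, ⟨M, hM⟩, hf⟩ := hw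
  have hlt : ∀ j, c j < 2 * k := by
    intro j
    obtain ⟨p', x, y, -, h2, h3⟩ := hs j
    have : y < 2 * k := h2.1
    simp only at h3
    omega
  have hm : m < k := by
    obtain ⟨j, -, e⟩ := hf 0
    have := hlt j
    omega
  let i : Fin k := ⟨m, hm⟩
  let z : Fin k := ⟨0, hA.pos⟩
  -- Deeper nodes over the same state are smaller, missing entries counting as top; this permits the
  -- change of level at time `M`.
  have hdown : ∀ p, ρ (i, p) ≤ ρ (z, p) := fun p =>
    (hρ _ _).2 (Or.inr ⟨Nat.zero_le _, hA.refl hA.pos p⟩)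
  refine ⟨fun j => if j ≤ M then ρ (z, q j) else ρ (i, q j),
    fun j => if M < j ∧ c j = m + m then 0 else 1, ⟨z, q 0, rfl, hq, by simp⟩, fun j => ?_, ?_⟩
  · beta_reduce
    rcases Nat.lt_or_ge j M with hj | hj
    · refine mem_rankTile_of_mem_epsLetterRel hA hρ (hs j) (i := z) (Nat.zero_le _) ?_ ?_ ?_
      · simp [hj.le]
      · simp [Nat.succ_le_of_lt hj]
      · simp [Nat.lt_asymm hj]
    · refine mem_rankTile_of_mem_epsLetterRel hA hρ (hs j) (i := i) ?_ ?_ ?_ ?_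
      · have := hM j hj
        simp only [i]
        omega
      · split_ifs
        · exact hdown _
        · exact le_rfl
      · simp [Nat.not_le.2 (Nat.lt_succ_of_le hj)]
      · intro h
        split_ifs at h with h'
        · simp only [i]
          omega
        · exact absurd h (by decide)
  · refine (parityAccepting_iff_evenLimInf (N := 2) fun j => Fin.is_lt _).2
      ⟨0, Even.zero, ⟨0, fun _ _ => Nat.zero_le _⟩, fun K => ?_⟩
    obtain ⟨j, hj, e⟩ := hf (max K (M + 1))
    exact ⟨j, by omega, by simp [e]; omega⟩

theorem mem_epsLanguage_of_mem_rankAutomaton_language (hA : A.IsEpsComplete)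
    (hρ : ∀ x y, ρ x ≤ ρ y ↔ NodeLE (fun i => A.EpsStep (2 * i + 1)) x y) {w : ℕ → α}
    (hw : (fun i => rankRenaming A ρ (w i)) ∈ (rankAutomaton A ρ).language) :
    w ∈ A.epsLanguage := by
  obtain ⟨v, r, ⟨z, p0, -, hp0, hv0⟩, hs, hacc⟩ := hw
  have hr : ∀ K, ∃ j, K ≤ j ∧ r j = 0 := by
    rw [parityAccepting_iff_evenLimInf (N := 2) fun j => Fin.is_lt _] at hacc
    obtain ⟨l, hl, -, hf⟩ := hacc
    intro K
    obtain ⟨j, hj, e⟩ := hf K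
    refine ⟨j, hj, Fin.ext ?_⟩
    have hlt := (r j).2
    obtain ⟨x, rfl⟩ := hl
    have hval : (r j : ℕ) = x + x := e
    show (r j : ℕ) = 0
    omega
  choose i p c q hM hic hvp hvq htie using hs
  simp only at hvp hvq htie
  -- The node reached before step `j`: the initial one, or the target of the previous simulated
  -- transition.
  let y : ℕ → Fin k × Q := fun j => Nat.casesOn j (z, p0) fun j => (i j, q j)
  have hy : ∀ j, v j ≤ ρ (y j) := by
    intro j
    cases j with
    | zero => exact hv0
    | succ j => exact hvq j
  choose e he hcase using fun j =>
    hA.exists_epsStep_of_nodeLE ((hρ (i j, p j) (y j)).1 ((hvp j).trans (hy j)))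
  -- The ε-loop of priority `2 * i j + 1` is appended so that the priorities of the constructed run
  -- also bound the levels.
  have hpath : ∀ j, A.EpsPath (y j).2 (min (e j) (2 * i j + 1)) (p j) := by
    intro j
    have hlt := (he j).1
    have h1 : A.EpsPath (y j).2 (min (2 * k) (e j)) (p j) :=
      (EpsPath.refl _).step (show (_, _, _) ∈ ParityAutomaton.letterRel A none from he j)
    rw [min_eq_right hlt.le] at h1
    exact h1.step (show (_, _, _) ∈ ParityAutomaton.letterRel A none from hA.refl (i j).2 (p j))
  let μ : ℕ → ℕ := fun j => min (min (e j) (2 * i j + 1)) (c j)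
  have hμb : ∀ j, μ j < 2 * k := fun j => by
    have := (he j).1
    simp only [μ]
    omega
  rw [epsLanguage_eq_acceptedWords]
  refine ⟨fun j => (y j).2, μ, hp0, fun j => ⟨p j, _, _, hpath j, hM j, rfl⟩, ?_⟩
  obtain ⟨l, hl⟩ := exists_hasLimInf hμb
  refine ⟨l, ?_, hl⟩
  by_contra hodd
  obtain ⟨m, rfl⟩ := Nat.not_even_iff_odd.1 hodd
  obtain ⟨⟨M, hlow⟩, hf⟩ := hl
  have hge : ∀ j, M ≤ j → m ≤ i j := fun j hj => by
    have := hlow j hj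
    simp only [μ] at this
    omega
  -- Leaving a level above `m` for `m` would cost an even priority at most `2 * m`, which no longer
  -- occurs.
  have hup : ∀ j, M ≤ j → m < i j → m < i (j + 1) := by
    intro j hj hm
    have h1 := hlow (j + 1) (by omega)
    have h2 : (y (j + 1)).1 = i j := rfl
    simp only [μ] at h1
    rcases hcase (j + 1) with ⟨d, h3, h4, h5⟩ | ⟨h3, h4⟩ | ⟨h3, h4, -⟩
    · simp only at h3
      omega
    · rw [h2, Fin.lt_def] at h4
      exact hm.trans h4
    · have h6 : i j = i (j + 1) := h4
      rwa [← h6]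
  -- Above level `m` for good, all priorities would exceed `2 * m + 1`, except even ones that differ
  -- from it, so this lim inf would not recur.
  have heq : ∀ j, M ≤ j → (i j : ℕ) = m := by
    intro j hj
    by_contra hne
    have hall : ∀ j', j ≤ j' → m < i j' := by
      intro j' hj'
      induction j', hj' using Nat.le_induction with
      | base => exact lt_of_le_of_ne (hge j hj) (Ne.symm hne)
      | succ j' h ih => exact hup j' (hj.trans h) ih
    obtain ⟨x, hx, ex⟩ := hf (j + 1)
    obtain ⟨x, rfl⟩ : ∃ x', x = x' + 1 := ⟨x - 1, by omega⟩
    have h1 := hall x (by omega)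
    have h2 := hall (x + 1) (by omega)
    have h3 := hic (x + 1)
    have h4 : (y (x + 1)).1 = i x := rfl
    simp only [μ] at ex
    rcases hcase (x + 1) with ⟨d, g1, g2, g3⟩ | ⟨g3, -⟩ | ⟨g3, -, -⟩
    · omega
    · rw [h4] at g3
      omega
    · rw [h4] at g3
      omega
  -- With the level constant and small even ε-priorities excluded, consecutive nodes are equivalent,
  -- which squeezes the Büchi state between equal ranks.
  have hnode : ∀ j, M ≤ j → ρ (i (j + 1), p (j + 1)) = v (j + 1) ∧ v (j + 1) = ρ (i j, q j) := by
    intro j hj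
    have h1 := hlow (j + 1) (by omega)
    have h2 := heq j hj
    have h3 := heq (j + 1) (by omega)
    have h4 : (y (j + 1)).1 = i j := rfl
    have hle : ρ (y (j + 1)) ≤ ρ (i (j + 1), p (j + 1)) := by
      simp only [μ] at h1
      rcases hcase (j + 1) with ⟨d, g1, g2, g3⟩ | ⟨-, g⟩ | ⟨-, -, g⟩
      · simp only at g1
        omega
      · rw [h4, Fin.lt_def] at g
        simp only at g
        omega
      · exact (hρ _ _).2 g
    exact ⟨le_antisymm (hvp _) ((hy _).trans hle), le_antisymm (hvq j) (hle.trans (hvp _))⟩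
  obtain ⟨j, hj, e0⟩ := hr (M + 1)
  obtain ⟨j, rfl⟩ : ∃ j', j = j' + 1 := ⟨j - 1, by omega⟩
  -- Nothing was gained from the upward closure here, so Büchi priority `0` forces priority `2 * m`,
  -- below the assumed lim inf.
  have h1 := htie (j + 1) (hnode j (by omega)).1 (hnode (j + 1) (by omega)).2 e0
  have h2 := hlow (j + 1) (by omega)
  have h3 := heq (j + 1) (by omega)
  simp only [μ] at h2
  omega

theorem epsLanguage_mono {N : ℕ} {A A' : EpsAutomaton α Q N} (hi : A.init ⊆ A'.init)
    (ht : A.trans ⊆ A'.trans) : A.epsLanguage ⊆ A'.epsLanguage := by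
  rintro w ⟨v, ⟨q, c, ⟨h0, hs⟩, hacc⟩, hv⟩
  exact ⟨v, ⟨q, c, ⟨hi h0, fun i => ht (hs i)⟩, hacc⟩, hv⟩

theorem IsEpsCompletable.exists_recognizesVia [Finite Q] (h : A.IsEpsCompletable)
    (hn : n = k * Nat.card Q) : ∃ (B : OrderedBuchiAutomaton (Fin n)) (f : α → B.tiles),
      B.RecognizesVia f A.epsLanguage ∧ Function.Surjective f := by
  obtain ⟨A', hinit, htrans, -, hA, hlang⟩ := h
  have hcard : Nat.card (Fin k × Q) = n := by rw [Nat.card_prod, Nat.card_fin, hn]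
  obtain ⟨ρ, hρ⟩ := exists_rank hcard (NodeLE fun i => A'.EpsStep (2 * i + 1))
    nodeLE_total (nodeLE_trans hA.total hA.trans hA.anti)
  have heq : A.epsLanguage = A'.epsLanguage :=
    (epsLanguage_mono hinit.ge htrans).antisymm hlang
  refine ⟨rankAutomaton A' ρ, rankRenaming A' ρ, fun w => ?_, ?_⟩
  · rw [heq]
    exact ⟨mem_rankAutomaton_language hA hρ, mem_epsLanguage_of_mem_rankAutomaton_language hA hρ⟩
  · rintro ⟨_, a, rfl⟩
    exact ⟨a, rfl⟩

end EpsAutomaton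

/-! ### Ramsey factorizations and equality of ω-languages -/

/-- Ramsey's theorem for pairs of natural numbers. -/
theorem exists_strictMono_of_finite_coloring {T : Type*} {S : Set T} (hS : S.Finite)
    {f : ℕ → ℕ → T} (hf : ∀ i j, i < j → f i j ∈ S) :
    ∃ e ∈ S, ∃ g : ℕ → ℕ, StrictMono g ∧ ∀ a b, a < b → f (g a) (g b) = e := by
  let U := Filter.hyperfilter ℕ
  have hgt : ∀ i, ∀ᶠ j in (U : Filter ℕ), i < j := fun i =>
    Nat.hyperfilter_le_atTop (Filter.eventually_gt_atTop i)
  have hcol : ∀ h : ℕ → T, (∀ᶠ j in (U : Filter ℕ), h j ∈ S) →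
      ∃ e ∈ S, ∀ᶠ j in (U : Filter ℕ), h j = e := by
    intro h hh
    have h1 : (⋃ e ∈ S, {j | h j = e}) ∈ U :=
      Filter.mem_of_superset hh fun j hj => Set.mem_biUnion hj rfl
    obtain ⟨e, he, h2⟩ := (Ultrafilter.finite_biUnion_mem_iff hS).1 h1
    exact ⟨e, he, h2⟩
  -- For a nonprincipal ultrafilter, `E i` is the colour of `f i j` for almost all `j`, and `e` is
  -- the value of `E i` for almost all `i`; the sequence `g` is then built greedily.
  choose E hE hE' using fun i => hcol (f i) ((hgt i).mono fun j hj => hf i j hj)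
  obtain ⟨e, he, hev⟩ := hcol E (Filter.Eventually.of_forall hE)
  obtain ⟨g, -, hg⟩ := exists_seq_of_forall_finset_exists (fun i => E i = e)
    (fun i j => i < j ∧ f i j = e) (fun s hs => by
      have h1 : ∀ᶠ j in (U : Filter ℕ), ∀ i ∈ s, i < j ∧ f i j = e :=
        (Filter.eventually_all_finset s).2 fun i hi =>
          ((hgt i).and (hE' i)).mono fun j hj => ⟨hj.1, hj.2.trans (hs i hi)⟩
      exact (hev.and h1).exists)
  exact ⟨e, he, g, strictMono_nat_of_lt_succ fun n => (hg n _ (Nat.lt_succ_self n)).1,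
    fun a b hab => (hg a b hab).2⟩

section Lasso

variable {Q β : Type*}

/-- There is an accepting lasso, with handle in `s` and loop in `e`. -/
def HasLasso (I : Set Q) (s e : Set (Q × ℕ × Q)) : Prop :=
  ∃ t ∈ s, t.1 ∈ I ∧ ∃ u ∈ e, u.1 = t.2.2 ∧ u.2.2 = t.2.2 ∧ Even u.2.1

theorem hasLasso_iff {I : Set Q} {s e : Set (Q × ℕ × Q)} :
    HasLasso I s e ↔ ∃ p c q d, (p, c, q) ∈ s ∧ p ∈ I ∧ (q, d, q) ∈ e ∧ Even d := by
  constructor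
  · rintro ⟨⟨p, c, q⟩, ht, hp, ⟨q1, d, q2⟩, hu, h1, h2, hd⟩
    simp only at h1 h2
    subst h1 h2
    exact ⟨p, c, _, d, ht, hp, hu, hd⟩
  · rintro ⟨p, c, q, d, ht, hp, hu, hd⟩
    exact ⟨_, ht, hp, _, hu, rfl, rfl, hd⟩

/-- By finiteness of `F` a run visits some state infinitely often. Two visits far enough apart
enclose an occurrence of the lim inf, and idempotence of `e` contracts the segment to a single loop
with that priority. -/
theorem mem_acceptedWords_iff_hasLasso {I : Set Q} {M : β → Set (Q × ℕ × Q)} {w : ℕ → β}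
    {g : ℕ → ℕ} (hg : StrictMono g) (h0 : g 0 = 0) {s e : Set (Q × ℕ × Q)}
    (hs : factorRel M w 0 (g 1 - 1) = s)
    (he : ∀ j, factorRel M w (g (j + 1)) (g (j + 2) - g (j + 1) - 1) = e)
    (hse : relComp s e = s) (hee : relComp e e = e) {F : Set Q} (hF : F.Finite)
    (heF : ∀ p c q, (p, c, q) ∈ e → q ∈ F) : w ∈ acceptedWords I M ↔ HasLasso I s e := by
  rw [mem_acceptedWords_iff_blocks hg h0, hasLasso_iff]
  have hs' : factorRel M w (g 0) (g (0 + 1) - g 0 - 1) = s := by simpa [h0] using hs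
  constructor
  · rintro ⟨q, c, hq, hrun, l, hl, ⟨K, hK⟩, hf⟩
    have hrun0 : (q 0, c 0, q 1) ∈ s := hs' ▸ hrun 0
    have hrun1 : ∀ j, (q (j + 1), c (j + 1), q (j + 2)) ∈ e := fun j => he j ▸ hrun (j + 1)
    have hhandle : ∀ j, ∃ d, (q 0, d, q (j + 1)) ∈ s := by
      intro j
      induction j with
      | zero => exact ⟨_, hrun0⟩
      | succ j ih =>
        obtain ⟨d, hd⟩ := ih
        refine ⟨_, hse ▸ mem_relComp.2 ⟨_, _, _, hd, hrun1 j, rfl⟩⟩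
    -- The priority `d` lies between `l` and every priority of the segment, so it equals `l` once
    -- `l` occurs there.
    have hloop : ∀ i, K ≤ i + 1 → ∀ j, ∃ d, (q (i + 1), d, q (i + j + 2)) ∈ e ∧ l ≤ d ∧
        ∀ t, t ≤ j → d ≤ c (i + t + 1) := by
      intro i hi j
      induction j with
      | zero =>
        refine ⟨_, hrun1 i, hK _ hi, fun t ht => ?_⟩
        obtain rfl : t = 0 := by omega
        exact le_rfl
      | succ j ih =>
        obtain ⟨d, hd, h1, h2⟩ := ih
        refine ⟨_, hee ▸ mem_relComp.2 ⟨_, _, _, hd, hrun1 (i + (j + 1)), rfl⟩,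
          le_min h1 (hK _ (by omega)), fun t ht => ?_⟩
        rcases Nat.lt_or_ge j t with h | h
        · obtain rfl : t = j + 1 := by omega
          exact min_le_right _ _
        · exact (min_le_left _ _).trans (h2 t h)
    have : Finite F := hF
    obtain ⟨⟨y, hyF⟩, hy⟩ := Finite.exists_infinite_fiber
      (fun j : ℕ => (⟨q (j + 2), heF _ _ _ (hrun1 j)⟩ : F))
    have hinf : ∀ a, ∃ j, a < j ∧ q (j + 2) = y := fun a => by
      obtain ⟨j, hj, ha⟩ := (Set.infinite_coe_iff.1 hy).exists_gt a
      exact ⟨j, ha, congrArg Subtype.val hj⟩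
    obtain ⟨i, hi, hqi⟩ := hinf K
    obtain ⟨x, hx, hcx⟩ := hf (i + 2)
    obtain ⟨j, hj, hqj⟩ := hinf x
    obtain ⟨d, hd⟩ := hhandle (i + 1)
    obtain ⟨d', hd', h1, h2⟩ := hloop (i + 1) (by omega) (j - i - 1)
    have h3 := h2 (x - i - 2) (by omega)
    rw [show i + 1 + (x - i - 2) + 1 = x by omega, hcx] at h3
    rw [show i + 1 + (j - i - 1) + 2 = j + 2 by omega, hqi, hqj] at hd'
    rw [hqi] at hd
    exact ⟨_, d, y, d', hd, hq, hd', le_antisymm h3 h1 ▸ hl⟩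
  · rintro ⟨p, c, q, d, h1, h2, h3, h4⟩
    refine ⟨fun j => Nat.casesOn j p fun _ => q, fun j => Nat.casesOn j c fun _ => d, h2,
      fun j => ?_, d, h4, ⟨1, fun j hj => ?_⟩, fun K => ⟨K + 1, Nat.le_succ K, rfl⟩⟩
    · cases j with
      | zero => exact hs' ▸ h1
      | succ j => exact he j ▸ h3
    · cases j with
      | zero => omega
      | succ j => exact le_rfl

theorem target_mem_of_mem_factorRel {M : β → Set (Q × ℕ × Q)} {F : Set Q}
    (hF : ∀ a p c q, (p, c, q) ∈ M a → q ∈ F) {w : ℕ → β} {i l : ℕ} {p q : Q} {c : ℕ}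
    (h : (p, c, q) ∈ factorRel M w i l) : q ∈ F := by
  cases l with
  | zero => exact hF _ _ _ _ h
  | succ l =>
    obtain ⟨r, a, b, -, h2, -⟩ := mem_relComp.1 h
    exact hF _ _ _ _ h2

end Lasso

theorem relComp_factorRel_of_lt {Q β : Type*} (M : β → Set (Q × ℕ × Q)) (w : ℕ → β) (a b c : ℕ)
    (hab : a < b) (hbc : b < c) :
    relComp (factorRel M w a (b - a - 1)) (factorRel M w b (c - b - 1)) =
      factorRel M w a (c - a - 1) := by
  have := relComp_factorRel M w a (b - a - 1) (c - b - 1)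
  rwa [show a + (b - a - 1) + 1 = b by omega,
    show b - a - 1 + (c - b - 1) + 1 = c - a - 1 by omega] at this

section LanguageEquality

variable {Q Q' β : Type*} {I : Set Q} {M : β → Set (Q × ℕ × Q)} {I' : Set Q'}
  {M' : β → Set (Q' × ℕ × Q')}

/-- A set of pairs of transition sets that contains those of the letters and is closed under
composition, on whose elements the two automata have the same accepting lassos. -/
structure IsEqualityCertificate (I : Set Q) (M : β → Set (Q × ℕ × Q)) (I' : Set Q')
    (M' : β → Set (Q' × ℕ × Q')) (S : Set (Set (Q × ℕ × Q) × Set (Q' × ℕ × Q'))) : Prop where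
  letter : ∀ a, (M a, M' a) ∈ S
  comp : ∀ s ∈ S, ∀ t ∈ S, (relComp s.1 t.1, relComp s.2 t.2) ∈ S
  lasso : ∀ s ∈ S, ∀ e ∈ S, relComp s.1 e.1 = s.1 → relComp s.2 e.2 = s.2 →
    relComp e.1 e.1 = e.1 → relComp e.2 e.2 = e.2 → (HasLasso I s.1 e.1 ↔ HasLasso I' s.2 e.2)

/-- The pairs of transition sets induced by the nonempty finite words. -/
def wordRels (M : β → Set (Q × ℕ × Q)) (M' : β → Set (Q' × ℕ × Q')) :
    Set (Set (Q × ℕ × Q) × Set (Q' × ℕ × Q')) :=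
  {s | ∃ w l, s = (factorRel M w 0 l, factorRel M' w 0 l)}

theorem IsEqualityCertificate.factorRel_mem
    {S : Set (Set (Q × ℕ × Q) × Set (Q' × ℕ × Q'))} (h : IsEqualityCertificate I M I' M' S)
    (w : ℕ → β) (i l : ℕ) : (factorRel M w i l, factorRel M' w i l) ∈ S := by
  induction l with
  | zero => exact h.letter _
  | succ l ih => exact h.comp _ ih _ (h.letter _)

/-- Factors are coloured by pairs of transition sets, so one Ramsey factorization serves both
automata and acceptance reduces to `h.lasso`. -/
theorem IsEqualityCertificate.acceptedWords_eq
    {S : Set (Set (Q × ℕ × Q) × Set (Q' × ℕ × Q'))} (h : IsEqualityCertificate I M I' M' S)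
    (hS : S.Finite) {F : Set Q} (hF : F.Finite) (hMF : ∀ a p c q, (p, c, q) ∈ M a → q ∈ F)
    {F' : Set Q'} (hF' : F'.Finite) (hMF' : ∀ a p c q, (p, c, q) ∈ M' a → q ∈ F') :
    acceptedWords I M = acceptedWords I' M' := by
  ext w
  obtain ⟨e, he, g, hg, hfg⟩ := exists_strictMono_of_finite_coloring hS
    (f := fun i j => (factorRel M w i (j - i - 1), factorRel M' w i (j - i - 1)))
    (fun i j _ => h.factorRel_mem w i _)
  have hlt : ∀ a b, a < b → g a < g b := fun a b hab => hg hab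
  have hfg1 : ∀ a b, a < b → factorRel M w (g a) (g b - g a - 1) = e.1 := fun a b hab =>
    congrArg Prod.fst (hfg a b hab)
  have hfg2 : ∀ a b, a < b → factorRel M' w (g a) (g b - g a - 1) = e.2 := fun a b hab =>
    congrArg Prod.snd (hfg a b hab)
  have hee1 : relComp e.1 e.1 = e.1 := by
    have := relComp_factorRel_of_lt M w _ _ _ (hlt 0 1 (by omega)) (hlt 1 2 (by omega))
    rwa [hfg1 0 1 (by omega), hfg1 1 2 (by omega), hfg1 0 2 (by omega)] at this
  have hee2 : relComp e.2 e.2 = e.2 := by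
    have := relComp_factorRel_of_lt M' w _ _ _ (hlt 0 1 (by omega)) (hlt 1 2 (by omega))
    rwa [hfg2 0 1 (by omega), hfg2 1 2 (by omega), hfg2 0 2 (by omega)] at this
  have h1pos : 0 < g 1 := (Nat.zero_le _).trans_lt (hlt 0 1 (by omega))
  -- The handle extends to `g 2`, not `g 1`: it then ends with a factor inducing `e`, and
  -- idempotence of `e` makes `e` absorbed by it.
  have hs1 : relComp (factorRel M w 0 (g 2 - 1)) e.1 = factorRel M w 0 (g 2 - 1) := by
    have := relComp_factorRel_of_lt M w 0 _ _ h1pos (hlt 1 2 (by omega))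
    rw [hfg1 1 2 (by omega), Nat.sub_zero, Nat.sub_zero] at this
    rw [← this, relComp_assoc, hee1]
  have hs2 : relComp (factorRel M' w 0 (g 2 - 1)) e.2 = factorRel M' w 0 (g 2 - 1) := by
    have := relComp_factorRel_of_lt M' w 0 _ _ h1pos (hlt 1 2 (by omega))
    rw [hfg2 1 2 (by omega), Nat.sub_zero, Nat.sub_zero] at this
    rw [← this, relComp_assoc, hee2]
  let G : ℕ → ℕ := fun j => Nat.casesOn j 0 fun j => g (j + 2)
  have hG : StrictMono G := by
    refine strictMono_nat_of_lt_succ fun j => ?_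
    cases j with
    | zero => exact (Nat.zero_le _).trans_lt (hlt 0 2 (by omega))
    | succ j => exact hlt _ _ (by omega)
  rw [mem_acceptedWords_iff_hasLasso hG rfl rfl (fun j => hfg1 _ _ (by omega)) hs1 hee1 hF
      fun p c q hpq => target_mem_of_mem_factorRel hMF (hfg1 0 1 (by omega) ▸ hpq),
    mem_acceptedWords_iff_hasLasso hG rfl rfl (fun j => hfg2 _ _ (by omega)) hs2 hee2 hF'
      fun p c q hpq => target_mem_of_mem_factorRel hMF' (hfg2 0 1 (by omega) ▸ hpq)]
  exact h.lasso _ (h.factorRel_mem w 0 (g 2 - 1)) _ he hs1 hs2 hee1 hee2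

/-- Composition is concatenation of words, and both lasso conditions express membership of the same
ultimately periodic word. -/
theorem isEqualityCertificate_wordRels (h : acceptedWords I M = acceptedWords I' M')
    {F : Set Q} (hF : F.Finite) (hMF : ∀ a p c q, (p, c, q) ∈ M a → q ∈ F)
    {F' : Set Q'} (hF' : F'.Finite) (hMF' : ∀ a p c q, (p, c, q) ∈ M' a → q ∈ F') :
    IsEqualityCertificate I M I' M' (wordRels M M') where
  letter a := ⟨fun _ => a, 0, rfl⟩
  comp := by
    rintro _ ⟨u, a, rfl⟩ _ ⟨v, b, rfl⟩
    let x : ℕ → β := fun t => if t < a + 1 then u t else v (t - (a + 1))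
    have h1 : ∀ t, t ≤ a → u (0 + t) = x (0 + t) := fun t ht => by
      simp only [x, Nat.zero_add, Nat.lt_succ_of_le ht, if_true]
    have h2 : ∀ t, t ≤ b → v (0 + t) = x (0 + a + 1 + t) := fun t ht => by
      have e1 : ¬ 0 + a + 1 + t < a + 1 := by omega
      have e2 : 0 + a + 1 + t - (a + 1) = 0 + t := by omega
      simp only [x, e1, if_false, e2]
    refine ⟨x, a + b + 1, ?_⟩
    rw [← relComp_factorRel, ← relComp_factorRel]
    simp only [factorRel_congr _ h1, factorRel_congr _ h2]
  lasso := by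
    rintro _ ⟨u, a, rfl⟩ _ ⟨v, b, rfl⟩ hs1 hs2 he1 he2
    -- The word `u v v v ⋯`, where the lengths of `u` and `v` are `a + 1` and `b + 1`.
    let x : ℕ → β := fun t => if t < a + 1 then u t else v ((t - (a + 1)) % (b + 1))
    let G : ℕ → ℕ := fun j => Nat.casesOn j 0 fun j => a + 1 + j * (b + 1)
    have hG1 : ∀ j, G (j + 1) = a + 1 + j * (b + 1) := fun j => rfl
    have hG2 : ∀ j, G (j + 2) = G (j + 1) + (b + 1) := fun j => by
      have : G (j + 2) = a + 1 + (j + 1) * (b + 1) := rfl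
      rw [Nat.succ_mul] at this
      rw [hG1 j]
      omega
    have hG : StrictMono G := by
      refine strictMono_nat_of_lt_succ fun j => ?_
      cases j with
      | zero =>
        rw [hG1]
        exact Nat.lt_of_lt_of_le (Nat.succ_pos a) (Nat.le_add_right _ _)
      | succ j => rw [hG2]; omega
    have h1 : ∀ t, t ≤ a → x (0 + t) = u (0 + t) := fun t ht => by
      simp only [x, Nat.zero_add, Nat.lt_succ_of_le ht, if_true]
    have h2 : ∀ j t, t ≤ b → x (G (j + 1) + t) = v (0 + t) := fun j t ht => by
      have e1 : ¬ G (j + 1) + t < a + 1 := by rw [hG1]; omega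
      have e2 : G (j + 1) + t - (a + 1) = t + j * (b + 1) := by rw [hG1]; omega
      simp only [x, e1, if_false, e2, Nat.add_mul_mod_self_right, Nat.zero_add]
      rw [Nat.mod_eq_of_lt (Nat.lt_succ_of_le ht)]
    have h3 : G 1 - 1 = a := by
      have : G 1 = a + 1 + 0 * (b + 1) := rfl
      omega
    have h4 : ∀ j, G (j + 2) - G (j + 1) - 1 = b := fun j => by rw [hG2]; omega
    have k1 : x ∈ acceptedWords I M ↔ _ := mem_acceptedWords_iff_hasLasso hG rfl
      (by rw [h3]; exact factorRel_congr _ h1)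
      (fun j => by rw [h4]; exact factorRel_congr _ (h2 j)) hs1 he1 hF
      fun p c q hpq => target_mem_of_mem_factorRel hMF hpq
    have k2 : x ∈ acceptedWords I' M' ↔ _ := mem_acceptedWords_iff_hasLasso hG rfl
      (by rw [h3]; exact factorRel_congr _ h1)
      (fun j => by rw [h4]; exact factorRel_congr _ (h2 j)) hs2 he2 hF'
      fun p c q hpq => target_mem_of_mem_factorRel hMF' hpq
    rw [← k1, ← k2, h]

end LanguageEquality

/-! ### Primitive recursive predicates with bounded quantifiers -/

section PrimrecClosure

variable {α β γ : Type*} [Primcodable α] [Primcodable β] [Primcodable γ]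

namespace PrimrecPred

theorem exists_mem {f : α → List β} {p : α → β → Prop} (hf : Primrec f)
    (hp : PrimrecPred fun z : α × β => p z.1 z.2) : PrimrecPred fun a => ∃ b ∈ f a, p a b :=
  (PrimrecRel.exists_mem_list (R := fun b a => p a b)
    (hp.comp (Primrec.pair Primrec.snd Primrec.fst))).comp hf Primrec.id

theorem forall_mem {f : α → List β} {p : α → β → Prop} (hf : Primrec f)
    (hp : PrimrecPred fun z : α × β => p z.1 z.2) : PrimrecPred fun a => ∀ b ∈ f a, p a b :=
  (PrimrecRel.forall_mem_list (R := fun b a => p a b)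
    (hp.comp (Primrec.pair Primrec.snd Primrec.fst))).comp hf Primrec.id

theorem imp {p q : α → Prop} (hp : PrimrecPred p) (hq : PrimrecPred q) :
    PrimrecPred fun a => p a → q a :=
  (hp.not.or hq).of_eq fun _ => imp_iff_not_or.symm

theorem iff {p q : α → Prop} (hp : PrimrecPred p) (hq : PrimrecPred q) :
    PrimrecPred fun a => p a ↔ q a :=
  ((hp.imp hq).and (hq.imp hp)).of_eq fun _ => iff_def.symm

theorem eq {f g : α → β} (hf : Primrec f) (hg : Primrec g) : PrimrecPred fun a => f a = g a :=
  Primrec.eq.comp hf hg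

theorem lt {f g : α → ℕ} (hf : Primrec f) (hg : Primrec g) : PrimrecPred fun a => f a < g a :=
  Primrec.nat_lt.comp hf hg

theorem le {f g : α → ℕ} (hf : Primrec f) (hg : Primrec g) : PrimrecPred fun a => f a ≤ g a :=
  Primrec.nat_le.comp hf hg

theorem list_mem {f : α → β} {g : α → List β} (hf : Primrec f) (hg : Primrec g) :
    PrimrecPred fun a => f a ∈ g a :=
  (exists_mem hg (p := fun a b => b = f a)
    (eq Primrec.snd (hf.comp Primrec.fst))).of_eq fun a => by simp

end PrimrecPred

theorem Primrec.fst_comp {f : α → β × γ} (hf : Primrec f) : Primrec fun a => (f a).1 :=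
  Primrec.fst.comp hf

theorem Primrec.snd_comp {f : α → β × γ} (hf : Primrec f) : Primrec fun a => (f a).2 :=
  Primrec.snd.comp hf

theorem Primrec.fun_id : Primrec fun a : α => a :=
  Primrec.id

theorem Primrec.some_comp {f : α → β} (hf : Primrec f) : Primrec fun a => some (f a) :=
  Primrec.option_some.comp hf

theorem Primrec.add_one {f : α → ℕ} (hf : Primrec f) : Primrec fun a => f a + 1 :=
  Primrec.succ.comp hf

theorem Primrec.mul {f g : α → ℕ} (hf : Primrec f) (hg : Primrec g) :
    Primrec fun a => f a * g a :=
  Primrec.nat_mul.comp hf hg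

theorem Primrec.mod {f g : α → ℕ} (hf : Primrec f) (hg : Primrec g) :
    Primrec fun a => f a % g a :=
  Primrec.nat_mod.comp hf hg

theorem Primrec.min {f g : α → ℕ} (hf : Primrec f) (hg : Primrec g) :
    Primrec fun a => min (f a) (g a) :=
  Primrec.nat_min.comp hf hg

theorem Primrec.range {f : α → ℕ} (hf : Primrec f) : Primrec fun a => List.range (f a) :=
  Primrec.list_range.comp hf

/-- The list of all sublists of a list. -/
def powerList {α : Type*} (l : List α) : List (List α) :=
  l.foldr (fun a acc => acc ++ acc.map (a :: ·)) [[]]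

theorem subset_of_mem_powerList {α : Type*} {l x : List α} (h : x ∈ powerList l) :
    ∀ t ∈ x, t ∈ l := by
  induction l generalizing x with
  | nil =>
    obtain rfl : x = [] := by simpa [powerList] using h
    simp
  | cons a l ih =>
    change x ∈ powerList l ++ (powerList l).map (a :: ·) at h
    rw [List.mem_append, List.mem_map] at h
    rcases h with h | ⟨y, hy, rfl⟩
    · exact fun t ht => List.mem_cons_of_mem _ (ih h t ht)
    · intro t ht
      rcases List.mem_cons.1 ht with rfl | ht
      · exact List.mem_cons_self
      · exact List.mem_cons_of_mem _ (ih hy t ht)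

theorem filter_mem_powerList {α : Type*} (P : α → Bool) (l : List α) :
    l.filter P ∈ powerList l := by
  induction l with
  | nil => simp [powerList]
  | cons a l ih =>
    change _ ∈ powerList l ++ (powerList l).map (a :: ·)
    rw [List.mem_append, List.mem_map]
    by_cases h : P a
    · exact Or.inr ⟨_, ih, by simp [h]⟩
    · exact Or.inl (by simpa [h] using ih)

/-- Any subset of `l`, decidable or not, is represented in `powerList l`, so quantification over
sets becomes bounded quantification over lists. -/
theorem exists_mem_powerList {α : Type*} (l : List α) (P : α → Prop) :
    ∃ x ∈ powerList l, ∀ t, t ∈ x ↔ t ∈ l ∧ P t := by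
  classical
  exact ⟨_, filter_mem_powerList (fun t => decide (P t)) l, by simp⟩

theorem Primrec.powerList {f : α → List β} (hf : Primrec f) :
    Primrec fun a => powerList (f a) := by
  refine Primrec.list_foldr (h := fun _ z => z.2 ++ z.2.map (z.1 :: ·)) hf (Primrec.const [[]]) ?_
  refine Primrec.list_append.comp (Primrec.snd.comp Primrec.snd)
    (Primrec.list_map (Primrec.snd.comp Primrec.snd) ?_)
  exact Primrec.list_cons.comp (Primrec.fst.comp (Primrec.snd.comp Primrec.fst)) Primrec.snd

/-- The list of all pairs with components in two lists. -/
def pairList {α β : Type*} (l : List α) (l' : List β) : List (α × β) :=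
  l.flatMap fun a => l'.map fun b => (a, b)

theorem mem_pairList {α β : Type*} {l : List α} {l' : List β} {t : α × β} :
    t ∈ pairList l l' ↔ t.1 ∈ l ∧ t.2 ∈ l' := by
  obtain ⟨a, b⟩ := t
  simp [pairList]

theorem Primrec.pairList {f : α → List β} {g : α → List γ} (hf : Primrec f) (hg : Primrec g) :
    Primrec fun a => pairList (f a) (g a) :=
  Primrec.list_flatMap hf (Primrec.list_map (hg.comp Primrec.fst)
    (Primrec.pair (Primrec.snd.comp Primrec.fst) Primrec.snd))

end PrimrecClosure

/-! ### Primitive recursive search for a certified solution -/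

/-- The list of all transitions with states below `n` and priorities below `N`. -/
def transitionList (n N : ℕ) : List (ℕ × ℕ × ℕ) :=
  pairList (List.range n) (pairList (List.range N) (List.range n))

theorem mem_transitionList {n N : ℕ} {t : ℕ × ℕ × ℕ} :
    t ∈ transitionList n N ↔ t.1 < n ∧ t.2.1 < N ∧ t.2.2 < n := by
  simp [transitionList, mem_pairList]

section CodedPredicates

/-- The `ε`-closure of the transitions of a coded automaton, as a least fixed point. -/
def CodedEpsPath (n N : ℕ) (D : List (ℕ × Option ℕ × ℕ × ℕ)) (t : ℕ × ℕ × ℕ) : Prop :=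
  ∀ z ∈ powerList (transitionList n (N + 1)), (∀ p ∈ List.range n, (p, N, p) ∈ z) →
    (∀ u ∈ z, ∀ d ∈ D, d.2.1 = none → d.1 = u.2.2 → d.2.2.1 < N → d.2.2.2 < n →
      (u.1, min u.2.1 d.2.2.1, d.2.2.2) ∈ z) → t ∈ z

/-- The transitions of a coded automaton over `ε* a`. -/
def CodedLetterRel (n N : ℕ) (D : List (ℕ × Option ℕ × ℕ × ℕ)) (a : ℕ) (t : ℕ × ℕ × ℕ) : Prop :=
  ∃ u ∈ transitionList n (N + 1), CodedEpsPath n N D u ∧ ∃ d ∈ D, d.2.1 = some a ∧ d.1 = u.2.2 ∧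
    d.2.2.1 < N ∧ d.2.2.2 < n ∧ t = (u.1, min u.2.1 d.2.2.1, d.2.2.2)

/-- `relComp x y = z`, for lists. -/
def IsListComp (x y z : List (ℕ × ℕ × ℕ)) : Prop :=
  (∀ t ∈ z, ∃ u ∈ x, ∃ v ∈ y, u.2.2 = v.1 ∧ t = (u.1, min u.2.1 v.2.1, v.2.2)) ∧
    ∀ u ∈ x, ∀ v ∈ y, u.2.2 = v.1 → (u.1, min u.2.1 v.2.1, v.2.2) ∈ z

/-- `HasLasso`, for lists. -/
def HasListLasso (I : List ℕ) (s e : List (ℕ × ℕ × ℕ)) : Prop :=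
  ∃ t ∈ s, t.1 ∈ I ∧ ∃ u ∈ e, u.1 = t.2.2 ∧ u.2.2 = t.2.2 ∧ u.2.1 % 2 = 0

/-- There is a certificate for the equality of the languages of a coded automaton with
`ε`-transitions and of a coded ordered Büchi automaton with `s` states. -/
def HasListCertificate (m n N : ℕ) (I : List ℕ) (D : List (ℕ × Option ℕ × ℕ × ℕ)) (s : ℕ)
    (y : OrderedBuchiCode) : Prop :=
  ∃ S ∈ powerList (pairList (powerList (transitionList n N)) (powerList (transitionList s 2))),
    (∀ a ∈ List.range m, ∃ z ∈ S, (∀ t ∈ transitionList n N, t ∈ z.1 ↔ CodedLetterRel n N D a t) ∧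
      ∀ t ∈ transitionList s 2, t ∈ z.2 ↔ (a, t) ∈ y.2) ∧
    (∀ u ∈ S, ∀ v ∈ S, ∃ z ∈ S, IsListComp u.1 v.1 z.1 ∧ IsListComp u.2 v.2 z.2) ∧
    ∀ u ∈ S, ∀ e ∈ S, IsListComp u.1 e.1 u.1 → IsListComp u.2 e.2 u.2 → IsListComp e.1 e.1 e.1 →
      IsListComp e.2 e.2 e.2 → (HasListLasso I u.1 e.1 ↔ HasListLasso y.1 u.2 e.2)

/-- The closure properties of the initial states and tiles of an ordered Büchi automaton. -/
def IsOrderedCode (s : ℕ) (y : OrderedBuchiCode) : Prop :=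
  (∀ q ∈ y.1, ∀ p ∈ List.range q, p ∈ y.1) ∧
    ∀ d ∈ y.2, ∀ t ∈ transitionList s 2, d.2.1 ≤ t.1 → t.2.2 ≤ d.2.2.2 →
      (d.2.1 = t.1 ∧ d.2.2.2 = t.2.2 → d.2.2.1 ≤ t.2.1) → (d.1, t) ∈ y.2

/-- `y` describes an ordered Büchi automaton that recognizes the language of the automaton coded
by `x`. -/
def IsSolution (y : OrderedBuchiCode) (x : EpsAutomatonCode) : Prop :=
  IsOrderedCode (x.2.2.1 * x.2.1) y ∧
    HasListCertificate x.1 x.2.1 (2 * x.2.2.1) x.2.2.2.1 x.2.2.2.2 (x.2.2.1 * x.2.1) y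

/-- All codes of ordered Büchi automata with `s` states over `m` letters. -/
def orderedBuchiCodes (m s : ℕ) : List OrderedBuchiCode :=
  pairList (powerList (List.range s)) (powerList (pairList (List.range m) (transitionList s 2)))

open Classical in
/-- The first solution among all codes of the right size. -/
noncomputable def firstSolution (x : EpsAutomatonCode) : OrderedBuchiCode :=
  (((orderedBuchiCodes x.1 (x.2.2.1 * x.2.1)).filter fun y => IsSolution y x).head?).getD ([], [])

variable {α : Type*} [Primcodable α]

theorem primrec_transitionList {f g : α → ℕ} (hf : Primrec f) (hg : Primrec g) :
    Primrec fun a => transitionList (f a) (g a) :=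
  Primrec.pairList (Primrec.list_range.comp hf)
    (Primrec.pairList (Primrec.list_range.comp hg) (Primrec.list_range.comp hf))

theorem primrecPred_codedEpsPath {n N : α → ℕ} {D : α → List (ℕ × Option ℕ × ℕ × ℕ)}
    {t : α → ℕ × ℕ × ℕ} (hn : Primrec n) (hN : Primrec N) (hD : Primrec D) (ht : Primrec t) :
    PrimrecPred fun a => CodedEpsPath (n a) (N a) (D a) (t a) := by
  -- With the parameters bundled in one tuple, every term is built from projections; since all
  -- quantifiers are bounded by lists, closure properties applied along the formula suffice.
  suffices h : PrimrecPred fun x : ℕ × ℕ × List (ℕ × Option ℕ × ℕ × ℕ) × (ℕ × ℕ × ℕ) =>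
      CodedEpsPath x.1 x.2.1 x.2.2.1 x.2.2.2 from
    h.comp (hn.pair (hN.pair (hD.pair ht)))
  unfold CodedEpsPath
  repeat' with_reducible first
    | exact Primrec.fun_id
    | exact Primrec.const _
    | apply PrimrecPred.forall_mem
    | apply PrimrecPred.imp
    | apply PrimrecPred.list_mem
    | apply PrimrecPred.eq
    | apply PrimrecPred.lt
    | apply Primrec.powerList
    | apply primrec_transitionList
    | apply Primrec.range
    | apply Primrec.add_one
    | apply Primrec.min
    | apply Primrec.fst_comp
    | apply Primrec.snd_comp
    | apply Primrec.pair

theorem primrecPred_codedLetterRel {n N b : α → ℕ} {D : α → List (ℕ × Option ℕ × ℕ × ℕ)}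
    {t : α → ℕ × ℕ × ℕ} (hn : Primrec n) (hN : Primrec N) (hD : Primrec D) (hb : Primrec b)
    (ht : Primrec t) : PrimrecPred fun a => CodedLetterRel (n a) (N a) (D a) (b a) (t a) := by
  suffices h : PrimrecPred fun x : ℕ × ℕ × List (ℕ × Option ℕ × ℕ × ℕ) × ℕ × (ℕ × ℕ × ℕ) =>
      CodedLetterRel x.1 x.2.1 x.2.2.1 x.2.2.2.1 x.2.2.2.2 from
    h.comp (hn.pair (hN.pair (hD.pair (hb.pair ht))))
  unfold CodedLetterRel
  repeat' with_reducible first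
    | exact Primrec.fun_id
    | exact Primrec.const _
    | apply primrecPred_codedEpsPath
    | apply PrimrecPred.exists_mem
    | apply PrimrecPred.and
    | apply PrimrecPred.eq
    | apply PrimrecPred.lt
    | apply primrec_transitionList
    | apply Primrec.add_one
    | apply Primrec.some_comp
    | apply Primrec.min
    | apply Primrec.fst_comp
    | apply Primrec.snd_comp
    | apply Primrec.pair

theorem primrecPred_isListComp {x y z : α → List (ℕ × ℕ × ℕ)} (hx : Primrec x) (hy : Primrec y)
    (hz : Primrec z) : PrimrecPred fun a => IsListComp (x a) (y a) (z a) := by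
  suffices h : PrimrecPred fun x : List (ℕ × ℕ × ℕ) × List (ℕ × ℕ × ℕ) × List (ℕ × ℕ × ℕ) =>
      IsListComp x.1 x.2.1 x.2.2 from h.comp (hx.pair (hy.pair hz))
  unfold IsListComp
  repeat' with_reducible first
    | exact Primrec.fun_id
    | apply PrimrecPred.exists_mem
    | apply PrimrecPred.forall_mem
    | apply PrimrecPred.imp
    | apply PrimrecPred.and
    | apply PrimrecPred.list_mem
    | apply PrimrecPred.eq
    | apply Primrec.min
    | apply Primrec.fst_comp
    | apply Primrec.snd_comp
    | apply Primrec.pair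

theorem primrecPred_hasListLasso {I : α → List ℕ} {s e : α → List (ℕ × ℕ × ℕ)} (hI : Primrec I)
    (hs : Primrec s) (he : Primrec e) : PrimrecPred fun a => HasListLasso (I a) (s a) (e a) := by
  suffices h : PrimrecPred fun x : List ℕ × List (ℕ × ℕ × ℕ) × List (ℕ × ℕ × ℕ) =>
      HasListLasso x.1 x.2.1 x.2.2 from h.comp (hI.pair (hs.pair he))
  unfold HasListLasso
  repeat' with_reducible first
    | exact Primrec.fun_id
    | exact Primrec.const _
    | apply PrimrecPred.exists_mem
    | apply PrimrecPred.and
    | apply PrimrecPred.list_mem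
    | apply PrimrecPred.eq
    | apply Primrec.mod
    | apply Primrec.fst_comp
    | apply Primrec.snd_comp

theorem primrecPred_hasListCertificate {m n N s : α → ℕ} {I : α → List ℕ}
    {D : α → List (ℕ × Option ℕ × ℕ × ℕ)} {y : α → OrderedBuchiCode} (hm : Primrec m)
    (hn : Primrec n) (hN : Primrec N) (hI : Primrec I) (hD : Primrec D) (hs : Primrec s)
    (hy : Primrec y) :
    PrimrecPred fun a => HasListCertificate (m a) (n a) (N a) (I a) (D a) (s a) (y a) := by
  suffices h : PrimrecPred fun x : ℕ × ℕ × ℕ × List ℕ × List (ℕ × Option ℕ × ℕ × ℕ) × ℕ ×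
      OrderedBuchiCode => HasListCertificate x.1 x.2.1 x.2.2.1 x.2.2.2.1 x.2.2.2.2.1
        x.2.2.2.2.2.1 x.2.2.2.2.2.2 from
    h.comp (f := fun a => (m a, n a, N a, I a, D a, s a, y a))
      (hm.pair (hn.pair (hN.pair (hI.pair (hD.pair (hs.pair hy))))))
  unfold HasListCertificate
  repeat' with_reducible first
    | exact Primrec.fun_id
    | exact Primrec.const _
    | apply primrecPred_codedLetterRel
    | apply primrecPred_isListComp
    | apply primrecPred_hasListLasso
    | apply PrimrecPred.exists_mem
    | apply PrimrecPred.forall_mem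
    | apply PrimrecPred.imp
    | apply PrimrecPred.iff
    | apply PrimrecPred.and
    | apply PrimrecPred.list_mem
    | apply Primrec.powerList
    | apply Primrec.pairList
    | apply primrec_transitionList
    | apply Primrec.range
    | apply Primrec.fst_comp
    | apply Primrec.snd_comp
    | apply Primrec.pair

theorem primrecPred_isOrderedCode {s : α → ℕ} {y : α → OrderedBuchiCode} (hs : Primrec s)
    (hy : Primrec y) : PrimrecPred fun a => IsOrderedCode (s a) (y a) := by
  suffices h : PrimrecPred fun x : ℕ × OrderedBuchiCode => IsOrderedCode x.1 x.2 from
    h.comp (hs.pair hy)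
  unfold IsOrderedCode
  repeat' with_reducible first
    | exact Primrec.fun_id
    | exact Primrec.const _
    | apply PrimrecPred.forall_mem
    | apply PrimrecPred.imp
    | apply PrimrecPred.and
    | apply PrimrecPred.list_mem
    | apply PrimrecPred.eq
    | apply PrimrecPred.le
    | apply primrec_transitionList
    | apply Primrec.range
    | apply Primrec.fst_comp
    | apply Primrec.snd_comp
    | apply Primrec.pair

theorem primrecRel_isSolution : PrimrecRel IsSolution := by
  refine PrimrecPred.primrecRel (p := fun z => IsSolution z.1 z.2) ?_
  unfold IsSolution
  repeat' with_reducible first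
    | exact Primrec.fun_id
    | exact Primrec.const _
    | apply primrecPred_isOrderedCode
    | apply primrecPred_hasListCertificate
    | apply PrimrecPred.and
    | apply Primrec.mul
    | apply Primrec.fst_comp
    | apply Primrec.snd_comp

theorem primrec_orderedBuchiCodes {f g : α → ℕ} (hf : Primrec f) (hg : Primrec g) :
    Primrec fun a => orderedBuchiCodes (f a) (g a) :=
  ((Primrec.list_range.comp hg).powerList).pairList
    (((Primrec.list_range.comp hf).pairList
      (primrec_transitionList hg (Primrec.const 2))).powerList)

theorem primrec_firstSolution : Primrec firstSolution := by
  classical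
  have hs : Primrec fun x : EpsAutomatonCode => x.2.2.1 * x.2.1 :=
    Primrec.nat_mul.comp (Primrec.fst_comp (Primrec.snd_comp Primrec.snd))
      (Primrec.fst_comp Primrec.snd)
  exact Primrec.option_getD.comp (Primrec.list_head?.comp
    ((PrimrecRel.listFilter primrecRel_isSolution).comp
      (primrec_orderedBuchiCodes Primrec.fst hs) Primrec.id)) (Primrec.const _)

end CodedPredicates

/-! ### Meaning of the coded predicates -/

section CodedSemantics

/-- A set of transitions between elements of `Fin n`, as one between natural numbers. -/
def valRel {n : ℕ} (X : Set (Fin n × ℕ × Fin n)) : Set (ℕ × ℕ × ℕ) :=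
  {t | ∃ (hp : t.1 < n) (hq : t.2.2 < n), (⟨t.1, hp⟩, t.2.1, ⟨t.2.2, hq⟩) ∈ X}

theorem acceptedWords_valRel {β : Type*} {n : ℕ} {I : Set (Fin n)} {J : Set ℕ}
    (hJ : ∀ q : Fin n, q ∈ I ↔ (q : ℕ) ∈ J) (M : β → Set (Fin n × ℕ × Fin n)) :
    acceptedWords J (fun a => valRel (M a)) = acceptedWords I M := by
  ext w
  constructor
  · rintro ⟨q, c, h0, hs, hacc⟩
    choose hp hq hs using hs
    exact ⟨fun i => ⟨q i, hp i⟩, c, (hJ _).2 h0, hs, hacc⟩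
  · rintro ⟨q, c, h0, hs, hacc⟩
    exact ⟨fun i => q i, c, (hJ _).1 h0, fun i => ⟨(q i).2, (q (i + 1)).2, hs i⟩, hacc⟩

theorem codedEpsPath_iff {m n k : ℕ} {I : List ℕ} {D : List (ℕ × Option ℕ × ℕ × ℕ)}
    {t : ℕ × ℕ × ℕ} : CodedEpsPath n (2 * k) D t ↔
      ∃ (hp : t.1 < n) (hq : t.2.2 < n),
        (codedEpsAutomaton m n k I D).EpsPath ⟨t.1, hp⟩ t.2.1 ⟨t.2.2, hq⟩ := by
  constructor
  · intro h
    -- The list of genuine ε-paths is itself closed, so it is an admissible instance. The bound `2 *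
    -- k + 1` makes room for the priority `2 * k` of empty paths.
    obtain ⟨z, hz, hzm⟩ := exists_mem_powerList (transitionList n (2 * k + 1)) fun t =>
      ∃ (hp : t.1 < n) (hq : t.2.2 < n),
        (codedEpsAutomaton m n k I D).EpsPath ⟨t.1, hp⟩ t.2.1 ⟨t.2.2, hq⟩
    refine ((hzm t).1 (h z hz (fun p hp => ?_) ?_)).2
    · rw [List.mem_range] at hp
      exact (hzm _).2 ⟨mem_transitionList.2 ⟨hp, Nat.lt_succ_self _, hp⟩, hp, hp, .refl _⟩
    · rintro ⟨p, c, q⟩ hu ⟨p', o, d, r⟩ hd ho hpq hdN hr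
      obtain ⟨-, hp, hq, hpath⟩ := (hzm _).1 hu
      simp only at ho hpq hdN hr hp hq hpath ⊢
      subst ho hpq
      have hl : ((⟨p', hq⟩ : Fin n), d, (⟨r, hr⟩ : Fin n)) ∈
          ParityAutomaton.letterRel (codedEpsAutomaton m n k I D) none := ⟨hdN, hd⟩
      exact (hzm _).2 ⟨mem_transitionList.2 ⟨hp, by simp only; omega, hr⟩, hp, hr, hpath.step hl⟩
  · obtain ⟨p, c, q⟩ := t
    rintro ⟨hp, hq, hpath⟩ z - hrefl hstep
    simp only at hp hq hpath
    suffices h : ∀ (p : Fin n) c (q : Fin n),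
        (codedEpsAutomaton m n k I D).EpsPath p c q → ((p : ℕ), c, (q : ℕ)) ∈ z from
      h _ _ _ hpath
    intro p c q h
    induction h with
    | refl => exact hrefl _ (List.mem_range.2 p.2)
    | @step q r c d _ h ih => exact hstep _ ih (q, none, d, r) h.2 rfl rfl h.1 r.2

theorem codedLetterRel_iff {m n k : ℕ} {I : List ℕ} {D : List (ℕ × Option ℕ × ℕ × ℕ)}
    {a : Fin m} {t : ℕ × ℕ × ℕ} : CodedLetterRel n (2 * k) D a t ↔
      t ∈ valRel ((codedEpsAutomaton m n k I D).epsLetterRel a) := by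
  constructor
  · rintro ⟨⟨p, c, q⟩, -, hpath, ⟨q', o, d, r⟩, hd, ho, hq', hdN, hr, rfl⟩
    obtain ⟨hp, hq, hpath⟩ := (codedEpsPath_iff (m := m) (I := I)).1 hpath
    simp only at ho hq' hdN hr
    subst ho hq'
    exact ⟨hp, hr, ⟨q', hq⟩, c, d, hpath, ⟨hdN, hd⟩, rfl⟩
  · obtain ⟨p, c, q⟩ := t
    rintro ⟨hp, hq, r, x, d, hpath, hd, hc⟩
    simp only at hc hpath hd
    subst hc
    have hpath' : CodedEpsPath n (2 * k) D (p, x, (r : ℕ)) :=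
      (codedEpsPath_iff (m := m) (I := I)).2 ⟨hp, r.2, hpath⟩
    have hx : x ≤ 2 * k := by
      cases hpath with
      | refl => exact le_rfl
      | step _ h => exact (min_le_right _ _).trans h.1.le
    exact ⟨(p, x, (r : ℕ)), mem_transitionList.2 ⟨hp, Nat.lt_succ_of_le hx, r.2⟩, hpath',
      (r, some a, d, q), hd.2, rfl, rfl, hd.1, hq, rfl⟩

theorem isListComp_iff {x y z : List (ℕ × ℕ × ℕ)} :
    IsListComp x y z ↔ relComp {t | t ∈ x} {t | t ∈ y} = {t | t ∈ z} := by
  constructor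
  · rintro ⟨h1, h2⟩
    ext t
    constructor
    · rintro ⟨u, hu, v, hv, he, rfl⟩
      exact h2 u hu v hv he
    · exact h1 t
  · intro h
    refine ⟨fun t ht => ?_, fun u hu v hv he => ?_⟩
    · have : t ∈ relComp {t | t ∈ x} {t | t ∈ y} := h ▸ ht
      exact this
    · have : (u.1, min u.2.1 v.2.1, v.2.2) ∈ relComp {t | t ∈ x} {t | t ∈ y} :=
        ⟨u, hu, v, hv, he, rfl⟩
      rwa [h] at this

theorem hasListLasso_iff {I : List ℕ} {s e : List (ℕ × ℕ × ℕ)} :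
    HasListLasso I s e ↔ HasLasso {q | q ∈ I} {t | t ∈ s} {t | t ∈ e} := by
  simp only [HasListLasso, HasLasso, Nat.even_iff, Set.mem_ofPred_eq]

theorem mem_transitionList_of_mem_factorRel {β : Type*} {n N : ℕ} {M : β → Set (ℕ × ℕ × ℕ)}
    (hM : ∀ a, ∀ t ∈ M a, t ∈ transitionList n N) {w : ℕ → β} {i l : ℕ} :
    ∀ t ∈ factorRel M w i l, t ∈ transitionList n N := by
  induction l with
  | zero => exact hM _
  | succ l ih =>
    rintro t ⟨u, hu, v, hv, -, rfl⟩
    have h1 := mem_transitionList.1 (ih u hu)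
    have h2 := mem_transitionList.1 (hM _ v hv)
    exact mem_transitionList.2 ⟨h1.1, (min_le_left _ _).trans_lt h1.2.1, h2.2.2⟩

theorem mem_transitionList_of_codedLetterRel {n N a : ℕ} {D : List (ℕ × Option ℕ × ℕ × ℕ)}
    {t : ℕ × ℕ × ℕ} (h : CodedLetterRel n N D a t) : t ∈ transitionList n N := by
  obtain ⟨u, hu, -, d, -, -, -, h1, h2, rfl⟩ := h
  exact mem_transitionList.2 ⟨(mem_transitionList.1 hu).1, (min_le_right _ _).trans_lt h1, h2⟩

/-- Such codes have no out-of-range entries, so runs over the lists are exactly runs of the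
automaton described. -/
theorem mem_of_mem_orderedBuchiCodes {m s : ℕ} {y : OrderedBuchiCode}
    (hy : y ∈ orderedBuchiCodes m s) :
    (∀ q ∈ y.1, q < s) ∧ ∀ d ∈ y.2, d.1 < m ∧ d.2 ∈ transitionList s 2 := by
  obtain ⟨h1, h2⟩ := mem_pairList.1 hy
  exact ⟨fun q hq => List.mem_range.1 (subset_of_mem_powerList h1 q hq), fun d hd => by
    have := mem_pairList.1 (subset_of_mem_powerList h2 d hd)
    exact ⟨List.mem_range.1 this.1, this.2⟩⟩

theorem hasListCertificate_iff {m n N s : ℕ} {I : List ℕ} {D : List (ℕ × Option ℕ × ℕ × ℕ)}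
    {y : OrderedBuchiCode} (hy : y ∈ orderedBuchiCodes m s) :
    HasListCertificate m n N I D s y ↔
      acceptedWords {q | q ∈ I} (fun a : Fin m => {t | CodedLetterRel n N D a t}) =
        acceptedWords {q | q ∈ y.1} (fun a : Fin m => {t | ((a : ℕ), t) ∈ y.2}) := by
  have hM : ∀ a : Fin m, ∀ t ∈ {t | CodedLetterRel n N D a t}, t ∈ transitionList n N :=
    fun a t ht => mem_transitionList_of_codedLetterRel ht
  have hM' : ∀ a : Fin m, ∀ t ∈ {t | ((a : ℕ), t) ∈ y.2}, t ∈ transitionList s 2 :=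
    fun a t ht => ((mem_of_mem_orderedBuchiCodes hy).2 _ ht).2
  have hF : ∀ (a : Fin m) p c q, (p, c, q) ∈ {t | CodedLetterRel n N D a t} → q ∈ Set.Iio n :=
    fun a p c q h => (mem_transitionList.1 (hM a _ h)).2.2
  have hF' : ∀ (a : Fin m) p c q, (p, c, q) ∈ {t | ((a : ℕ), t) ∈ y.2} → q ∈ Set.Iio s :=
    fun a p c q h => (mem_transitionList.1 (hM' a _ h)).2.2
  constructor
  · rintro ⟨S, hS, hletter, hcomp, hlasso⟩
    let toSets : List (ℕ × ℕ × ℕ) × List (ℕ × ℕ × ℕ) → Set (ℕ × ℕ × ℕ) × Set (ℕ × ℕ × ℕ) :=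
      fun z => ({t | t ∈ z.1}, {t | t ∈ z.2})
    have hcert : IsEqualityCertificate {q | q ∈ I}
        (fun a : Fin m => {t | CodedLetterRel n N D a t}) {q | q ∈ y.1}
        (fun a : Fin m => {t | ((a : ℕ), t) ∈ y.2}) (toSets '' {z | z ∈ S}) := by
      refine ⟨fun a => ?_, ?_, ?_⟩
      · obtain ⟨z, hz, h1, h2⟩ := hletter a (List.mem_range.2 a.2)
        obtain ⟨h3, h4⟩ := mem_pairList.1 (subset_of_mem_powerList hS z hz)
        refine ⟨z, hz, Prod.ext (Set.ext fun t => ?_) (Set.ext fun t => ?_)⟩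
        · exact ⟨fun ht => (h1 t (subset_of_mem_powerList h3 t ht)).1 ht,
            fun ht => (h1 t (hM a t ht)).2 ht⟩
        · exact ⟨fun ht => (h2 t (subset_of_mem_powerList h4 t ht)).1 ht,
            fun ht => (h2 t (hM' a t ht)).2 ht⟩
      · rintro _ ⟨u, hu, rfl⟩ _ ⟨v, hv, rfl⟩
        obtain ⟨z, hz, h1, h2⟩ := hcomp u hu v hv
        exact ⟨z, hz, Prod.ext (isListComp_iff.1 h1).symm (isListComp_iff.1 h2).symm⟩
      · rintro _ ⟨u, hu, rfl⟩ _ ⟨e, he, rfl⟩ h1 h2 h3 h4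
        have := hlasso u hu e he (isListComp_iff.2 h1) (isListComp_iff.2 h2)
          (isListComp_iff.2 h3) (isListComp_iff.2 h4)
        rwa [hasListLasso_iff, hasListLasso_iff] at this
    exact hcert.acceptedWords_eq (S.finite_toSet.image toSets) (Set.finite_Iio n) hF
      (Set.finite_Iio s) hF'
  · intro h
    obtain ⟨hletter, hcomp, hlasso⟩ :=
      isEqualityCertificate_wordRels h (Set.finite_Iio n) hF (Set.finite_Iio s) hF'
    set W := wordRels (fun a : Fin m => {t | CodedLetterRel n N D a t})
      (fun a : Fin m => {t | ((a : ℕ), t) ∈ y.2}) with hW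
    -- `S` collects all listed pairs that represent the transition sets of a word, possibly with
    -- several representatives of the same sets.
    obtain ⟨S, hS, hSm⟩ := exists_mem_powerList
      (pairList (powerList (transitionList n N)) (powerList (transitionList s 2)))
      fun z => (({t | t ∈ z.1}, {t | t ∈ z.2}) : Set (ℕ × ℕ × ℕ) × Set (ℕ × ℕ × ℕ)) ∈ W
    have hlift : ∀ x ∈ W, ∃ z ∈ S, {t | t ∈ z.1} = x.1 ∧ {t | t ∈ z.2} = x.2 := by
      intro x hx
      obtain ⟨w, l, rfl⟩ := hx
      obtain ⟨z, hz, hzm⟩ := exists_mem_powerList (transitionList n N)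
        fun t => t ∈ factorRel (fun a : Fin m => {t | CodedLetterRel n N D a t}) w 0 l
      obtain ⟨z', hz', hzm'⟩ := exists_mem_powerList (transitionList s 2)
        fun t => t ∈ factorRel (fun a : Fin m => {t | ((a : ℕ), t) ∈ y.2}) w 0 l
      have e1 : {t | t ∈ z} = factorRel (fun a : Fin m => {t | CodedLetterRel n N D a t}) w 0 l :=
        Set.ext fun t => (hzm t).trans
          (and_iff_right_of_imp (mem_transitionList_of_mem_factorRel hM t))
      have e2 : {t | t ∈ z'} = factorRel (fun a : Fin m => {t | ((a : ℕ), t) ∈ y.2}) w 0 l :=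
        Set.ext fun t => (hzm' t).trans
          (and_iff_right_of_imp (mem_transitionList_of_mem_factorRel hM' t))
      refine ⟨(z, z'), (hSm _).2 ⟨mem_pairList.2 ⟨hz, hz'⟩, w, l, ?_⟩, e1, e2⟩
      simp only [e1, e2]
    refine ⟨S, hS, fun a ha => ?_, fun u hu v hv => ?_, fun u hu e he h1 h2 h3 h4 => ?_⟩
    · obtain ⟨z, hz, h1, h2⟩ := hlift _ (hletter ⟨a, List.mem_range.1 ha⟩)
      exact ⟨z, hz, fun t _ => Set.ext_iff.1 h1 t, fun t _ => Set.ext_iff.1 h2 t⟩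
    · obtain ⟨z, hz, h1, h2⟩ := hlift _ (hcomp _ ((hSm u).1 hu).2 _ ((hSm v).1 hv).2)
      exact ⟨z, hz, isListComp_iff.2 h1.symm, isListComp_iff.2 h2.symm⟩
    · rw [hasListLasso_iff, hasListLasso_iff]
      exact hlasso _ ((hSm u).1 hu).2 _ ((hSm e).1 he).2 (isListComp_iff.1 h1)
        (isListComp_iff.1 h2) (isListComp_iff.1 h3) (isListComp_iff.1 h4)

theorem OrderedBuchiCode.Describes.mem_language_iff {m s : ℕ} {y : OrderedBuchiCode}
    {B : OrderedBuchiAutomaton (Fin s)} {f : Fin m → B.tiles} (h : y.Describes B f)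
    (hy : y ∈ orderedBuchiCodes m s) (w : ℕ → Fin m) :
    (fun i => f (w i)) ∈ B.language ↔
      w ∈ acceptedWords {q | q ∈ y.1} (fun a : Fin m => {t | ((a : ℕ), t) ∈ y.2}) := by
  let A : ParityAutomaton (Fin m) (Fin s) 2 :=
    ⟨B.init, {t | (t.1, t.2.2.1, t.2.2.2) ∈ (f t.2.1 : BuchiTile (Fin s))}⟩
  have hA : w ∈ A.language ↔ (fun i => f (w i)) ∈ B.language :=
    ⟨fun ⟨q, r, ⟨h0, hs⟩, hacc⟩ => ⟨q, r, h0, hs, hacc⟩,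
      fun ⟨q, r, h0, hs, hacc⟩ => ⟨q, r, ⟨h0, hs⟩, hacc⟩⟩
  have hrel : (fun a => valRel (A.letterRel a)) = fun a : Fin m => {t | ((a : ℕ), t) ∈ y.2} := by
    funext a
    ext ⟨p, c, q⟩
    constructor
    · rintro ⟨hp, hq, hc, ht⟩
      exact (h.2.1 a ⟨p, hp⟩ ⟨c, hc⟩ ⟨q, hq⟩).1 ht
    · intro ht
      obtain ⟨hp, hc, hq⟩ := mem_transitionList.1 ((mem_of_mem_orderedBuchiCodes hy).2 _ ht).2
      exact ⟨hp, hq, hc, (h.2.1 a ⟨p, hp⟩ ⟨c, hc⟩ ⟨q, hq⟩).2 ht⟩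
  rw [← hA, ParityAutomaton.language_eq_acceptedWords, ← hrel,
    acceptedWords_valRel (J := {q | q ∈ y.1}) h.1]

theorem OrderedBuchiCode.Describes.hasListCertificate_iff {m n k s : ℕ} {I : List ℕ}
    {D : List (ℕ × Option ℕ × ℕ × ℕ)} {y : OrderedBuchiCode}
    {B : OrderedBuchiAutomaton (Fin s)} {f : Fin m → B.tiles} (h : y.Describes B f)
    (hy : y ∈ orderedBuchiCodes m s) : HasListCertificate m n (2 * k) I D s y ↔
      B.RecognizesVia f (codedEpsAutomaton m n k I D).epsLanguage := by
  have hrel : (fun a : Fin m => {t | CodedLetterRel n (2 * k) D a t}) =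
      fun a => valRel ((codedEpsAutomaton m n k I D).epsLetterRel a) :=
    funext fun a => Set.ext fun t => codedLetterRel_iff
  rw [_root_.hasListCertificate_iff hy, hrel,
    acceptedWords_valRel (I := (codedEpsAutomaton m n k I D).init) (fun q => Iff.rfl),
    ← EpsAutomaton.epsLanguage_eq_acceptedWords, Set.ext_iff]
  exact forall_congr' fun w => by rw [h.mem_language_iff hy]

theorem OrderedBuchiCode.Describes.isOrderedCode {m s : ℕ} {y : OrderedBuchiCode}
    {B : OrderedBuchiAutomaton (Fin s)} {f : Fin m → B.tiles} (h : y.Describes B f)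
    (hy : y ∈ orderedBuchiCodes m s) : IsOrderedCode s y := by
  obtain ⟨hy1, hy2⟩ := mem_of_mem_orderedBuchiCodes hy
  refine ⟨fun q hq p hp => ?_, ?_⟩
  · have hpq := List.mem_range.1 hp
    have hqs := hy1 q hq
    exact (h.1 ⟨p, hpq.trans hqs⟩).1
      (B.init_lower _ ⟨q, hqs⟩ (Fin.mk_le_mk.2 hpq.le) ((h.1 ⟨q, hqs⟩).2 hq))
  · rintro ⟨a, p, c, q⟩ hd ⟨p', c', q'⟩ ht h1 h2 h3
    obtain ⟨ha, hd'⟩ := hy2 _ hd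
    obtain ⟨hp, hc, hq⟩ := mem_transitionList.1 hd'
    obtain ⟨hp', hc', hq'⟩ := mem_transitionList.1 ht
    simp only at ha hp hc hq hp' hc' hq' h1 h2 h3 ⊢
    refine (h.2.1 ⟨a, ha⟩ ⟨p', hp'⟩ ⟨c', hc'⟩ ⟨q', hq'⟩).1 (B.tiles_upper _ (f ⟨a, ha⟩).2
      (⟨p, hp⟩, ⟨c, hc⟩, ⟨q, hq⟩) _ ((h.2.1 ⟨a, ha⟩ _ _ _).2 hd) ⟨h1, h2, fun he => ?_⟩)
    exact h3 ⟨congrArg Fin.val he.1, congrArg Fin.val he.2⟩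

theorem IsOrderedCode.exists_describes {m s : ℕ} {y : OrderedBuchiCode} (h : IsOrderedCode s y) :
    ∃ (B : OrderedBuchiAutomaton (Fin s)) (f : Fin m → B.tiles), y.Describes B f := by
  let tile : Fin m → BuchiTile (Fin s) := fun a =>
    {t | ((a : ℕ), (t.1 : ℕ), (t.2.1 : ℕ), (t.2.2 : ℕ)) ∈ y.2}
  let B : OrderedBuchiAutomaton (Fin s) :=
    { init := {q | (q : ℕ) ∈ y.1}
      init_lower := fun p q hpq hq => by
        rcases hpq.eq_or_lt with rfl | hlt
        · exact hq
        · exact h.1 q hq p (List.mem_range.2 hlt)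
      tiles := Set.range tile
      tiles_upper := by
        rintro _ ⟨a, rfl⟩ ⟨p, c, q⟩ ⟨p', c', q'⟩ hd ⟨h1, h2, h3⟩
        exact h.2 _ hd ((p' : ℕ), (c' : ℕ), (q' : ℕ))
          (mem_transitionList.2 ⟨p'.2, c'.2, q'.2⟩) h1 h2
          fun he => h3 ⟨Fin.ext he.1, Fin.ext he.2⟩ }
  refine ⟨B, fun a => ⟨tile a, a, rfl⟩, fun q => Iff.rfl, fun a p c q => Iff.rfl, ?_⟩
  rintro ⟨_, a, rfl⟩
  exact ⟨a, rfl⟩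

theorem exists_describes {m s : ℕ} {B : OrderedBuchiAutomaton (Fin s)} {f : Fin m → B.tiles}
    (hf : Function.Surjective f) : ∃ y ∈ orderedBuchiCodes m s, y.Describes B f := by
  obtain ⟨J, hJ, hJm⟩ := exists_mem_powerList (List.range s) fun q => ∃ h : q < s, ⟨q, h⟩ ∈ B.init
  obtain ⟨T, hT, hTm⟩ := exists_mem_powerList (pairList (List.range m) (transitionList s 2))
    fun d => ∃ (ha : d.1 < m) (hp : d.2.1 < s) (hc : d.2.2.1 < 2) (hq : d.2.2.2 < s),
      (⟨d.2.1, hp⟩, ⟨d.2.2.1, hc⟩, ⟨d.2.2.2, hq⟩) ∈ (f ⟨d.1, ha⟩ : BuchiTile (Fin s))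
  refine ⟨(J, T), mem_pairList.2 ⟨hJ, hT⟩, fun q => ?_, fun a p c q => ?_, hf⟩
  · rw [hJm]
    exact ⟨fun h => ⟨List.mem_range.2 q.2, q.2, h⟩, fun h => h.2.2⟩
  · rw [hTm]
    refine ⟨fun h => ⟨mem_pairList.2 ⟨List.mem_range.2 a.2,
      mem_transitionList.2 ⟨p.2, c.2, q.2⟩⟩, a.2, p.2, c.2, q.2, h⟩, ?_⟩
    rintro ⟨-, _, _, _, _, h⟩
    exact h

theorem firstSolution_mem {x : EpsAutomatonCode}
    (h : ∃ y ∈ orderedBuchiCodes x.1 (x.2.2.1 * x.2.1), IsSolution y x) :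
    firstSolution x ∈ orderedBuchiCodes x.1 (x.2.2.1 * x.2.1) ∧ IsSolution (firstSolution x) x := by
  classical
  obtain ⟨y, hy, hsol⟩ := h
  have hmem : y ∈ (orderedBuchiCodes x.1 (x.2.2.1 * x.2.1)).filter fun y => IsSolution y x :=
    List.mem_filter.2 ⟨hy, decide_eq_true hsol⟩
  have hfirst : firstSolution x ∈
      (orderedBuchiCodes x.1 (x.2.2.1 * x.2.1)).filter fun y => IsSolution y x := by
    unfold firstSolution
    generalize hL : ((orderedBuchiCodes x.1 (x.2.2.1 * x.2.1)).filter
      fun y => IsSolution y x) = L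
    rw [hL] at hmem
    -- The solution `y` shows that the list is nonempty, so the default `([], [])` is not used.
    cases L with
    | nil => simp at hmem
    | cons z L => exact List.mem_cons_self
  obtain ⟨h1, h2⟩ := List.mem_filter.1 hfirst
  exact ⟨h1, of_decide_eq_true h2⟩

end CodedSemantics

/-- First part: the transformation, for arbitrary finite alphabets and state sets. Second part: it
is effective, that is, it is realized by a computable function on finite descriptions. -/
theorem mainTheorem2 :
    (∀ {α : Type*} {Q : Type*} [Finite α] [Finite Q] (k : ℕ) (A : EpsAutomaton α Q (2 * k)),
      A.IsEpsCompletable →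
        ∃ (B : OrderedBuchiAutomaton (Fin (k * Nat.card Q))) (f : α → B.tiles),
          B.RecognizesVia f A.epsLanguage) ∧
    (∃ F : EpsAutomatonCode → OrderedBuchiCode, Computable F ∧
      ∀ (m n k : ℕ) (I : List ℕ) (D : List (ℕ × Option ℕ × ℕ × ℕ)),
        (codedEpsAutomaton m n k I D).IsEpsCompletable →
          ∃ (B : OrderedBuchiAutomaton (Fin (k * n))) (f : Fin m → B.tiles),
            (F (m, n, k, I, D)).Describes B f ∧
              B.RecognizesVia f (codedEpsAutomaton m n k I D).epsLanguage) := by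
  refine ⟨fun {α Q} _ _ k A hA => ?_, firstSolution, primrec_firstSolution.to_comp,
    fun m n k I D hA => ?_⟩
  · obtain ⟨B, f, h, -⟩ := hA.exists_recognizesVia rfl
    exact ⟨B, f, h⟩
  · obtain ⟨B, f, hrec, hf⟩ := hA.exists_recognizesVia (n := k * n) (by rw [Nat.card_fin])
    obtain ⟨y, hy, hdesc⟩ := exists_describes hf
    obtain ⟨hmem, hord, hcert⟩ := firstSolution_mem (x := (m, n, k, I, D))
      ⟨y, hy, hdesc.isOrderedCode hy, (hdesc.hasListCertificate_iff hy).2 hrec⟩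
    -- The code found may differ from `y`; its certificate ensures recognition for any automaton it
    -- describes.
    obtain ⟨B', f', hdesc'⟩ := hord.exists_describes (m := m)
    exact ⟨B', f', hdesc', (hdesc'.hasListCertificate_iff hmem).1 hcert⟩
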